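/- There exists an absolute constant $C>0$ such that the following holds for every positive integer $n$. Let $A\subseteq\{1,\dots,n\}$ be a set of size $m\ge C\sqrt{n}$. Then there exists an integer $d\ge 1$ such that, writing $A'=\{x/d : x\in A,\ d\mid x\}$ and $k=2^{50}n/m$, the set $$\Sigma^{[k]}(A')=\Big\{\sum_{s\in S}s : S\subseteq A',\ |S|\le k\Big\}$$ of sums of at most $k$ distinct elements of $A'$ contains an interval of length at least $n$, that is, at least $n$ consecutive integers, and, for the same $d$, $$|A|-|A'|\le 2^{30}(\log n)^{3}+\frac{2^{30}n}{m},$$ where $\log$ denotes the natural logarithm. -/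

import Mathlib

/-- `Σ^{[h]}(A)`: the sums of the elements of `S`, over all subsets `S ⊆ A` with at most `h`
elements (the empty set is allowed; the bound `h` may be any real number). -/
def shortSubsetSums (h : ℝ) (A : Finset ℕ) : Set ℕ :=
  {s | ∃ S : Finset ℕ, S ⊆ A ∧ (S.card : ℝ) ≤ h ∧ ∑ x ∈ S, x = s}

/-- The set `{x / d : x ∈ A, d ∣ x}`. -/
def divisibleQuotients (d : ℕ) (A : Finset ℕ) : Finset ℕ :=
  (A.filter (fun x => d ∣ x)).image (fun x => x / d)

/-! Write m = |A|. Subset sums are grown one element at a time: adjoining a to the available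
summands turns a set X of sums into X ∪ (X + a), which gains |(X + a) \ X| elements. This gain is
subadditive and even in a. If every available a gave a small gain, so would every element of an
iterated signed sumset of the available elements, and counting pairs in X × X shows that only few
shifts can have small gain. As the iterated sumsets grow quadratically (`card_nsmul_signedSet`),
some a always gives a large gain.

The argument needs a set that keeps its size, an element above half its range, and gcd one after any
small deletion (`RobustSet`). For such a set in [1, N], `RobustSet.exists_many_sums` produces many
sums from few elements. Many disjoint blocks of this kind share a large difference M by pigeonhole,
which gives a long progression of step M; two further disjoint blocks of sums each cover more than
half the residues modulo M. Together they fill an interval (`RobustSet.exists_interval`).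

A robust set is obtained by dividing A by some d and truncating dyadically (`exists_robustSet`).
Robustness concerns only the truncation, so d may fail to divide many elements of A.
`exists_divisor_cover` therefore replaces d by a divisor d' = d/q dividing all but 2d ≤ 4n/m
elements, such that elements of A/d' which are not multiples of q have sums in every class modulo q.
These repair the residues (`interval_of_cover`). -/

open Finset Pointwise

/-! ### Gain of a set under translation, and growth of iterated sumsets in a finite group -/

section ShiftGain

variable {G : Type*} [AddCommGroup G] [DecidableEq G]

/-- The number of elements of the translate `X + b` that lie outside `X`. -/
def shiftGain (X : Finset G) (b : G) : ℕ := (X.image (· + b) \ X).card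

lemma card_image_add_right (X : Finset G) (b : G) : (X.image (· + b)).card = X.card :=
  card_image_of_injective _ (add_left_injective b)

lemma card_inter_add_shiftGain (X : Finset G) (b : G) :
    (X.image (· + b) ∩ X).card + shiftGain X b = X.card := by
  rw [shiftGain, card_inter_add_card_sdiff, card_image_add_right]

lemma card_union_image_add (X : Finset G) (b : G) :
    (X ∪ X.image (· + b)).card = X.card + shiftGain X b := by
  rw [shiftGain, ← union_sdiff_self_eq_union, card_union_of_disjoint disjoint_sdiff]

lemma shiftGain_zero (X : Finset G) : shiftGain X 0 = 0 := by
  simp [shiftGain]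

/-- If x + b + c leaves X, then either x + b has already left X, or c moves a point of X out of X.
-/
lemma shiftGain_add (X : Finset G) (b c : G) :
    shiftGain X (b + c) ≤ shiftGain X b + shiftGain X c := by
  have h : X.image (· + (b + c)) \ X ⊆
      (X.image (· + b) \ X).image (· + c) ∪ (X.image (· + c) \ X) := by
    intro y hy
    simp only [mem_sdiff, mem_image, mem_union] at hy ⊢
    obtain ⟨⟨x, hx, rfl⟩, hy⟩ := hy
    by_cases hb : x + b ∈ X
    · exact Or.inr ⟨⟨x + b, hb, by abel⟩, hy⟩
    · exact Or.inl ⟨x + b, ⟨⟨x, hx, rfl⟩, hb⟩, by abel⟩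
  calc shiftGain X (b + c) ≤ _ := card_le_card h
    _ ≤ _ := card_union_le _ _
    _ = _ := by rw [card_image_add_right]; rfl

lemma shiftGain_neg (X : Finset G) (b : G) : shiftGain X (-b) = shiftGain X b := by
  have h : (X.image (· + -b) ∩ X).card = (X.image (· + b) ∩ X).card := by
    rw [← card_image_add_right (X.image (· + -b) ∩ X) b]
    congr 1
    ext y
    simp only [mem_image, mem_inter]
    constructor
    · rintro ⟨z, ⟨⟨x, hx, rfl⟩, hz⟩, rfl⟩
      exact ⟨⟨_, hz, rfl⟩, by simpa using hx⟩
    · rintro ⟨⟨x, hx, rfl⟩, hy⟩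
      exact ⟨x, ⟨⟨x + b, hy, by abel⟩, hx⟩, rfl⟩
  have h1 := card_inter_add_shiftGain X b
  have h2 := card_inter_add_shiftGain X (-b)
  omega

lemma shiftGain_le_of_mem_nsmul {X B : Finset G} {g : ℕ} (hg : ∀ b ∈ B, shiftGain X b ≤ g)
    (j : ℕ) : ∀ b ∈ j • B, shiftGain X b ≤ j * g := by
  induction j with
  | zero => intro b hb; simp at hb; subst hb; simp [shiftGain_zero]
  | succ j ih =>
    intro b hb
    rw [succ_nsmul, mem_add] at hb
    obtain ⟨x, hx, y, hy, rfl⟩ := hb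
    have := shiftGain_add X x y
    have := ih x hx
    have := hg y hy
    linarith

/-- Few translates of `X` can meet `X` in a large part of it. -/
lemma card_mul_card_le_of_shiftGain_le {X P : Finset G} {g : ℕ}
    (hg : ∀ b ∈ P, shiftGain X b ≤ g) :
    P.card * X.card ≤ X.card * X.card + P.card * g := by
  -- A point y of the overlap for b is recorded as (y - b, y) in X × X, and the difference recovers
  -- b.
  have h1 : ∑ b ∈ P, (X.image (· + b) ∩ X).card ≤ X.card * X.card := by
    rw [← card_sigma, ← card_product]
    refine card_le_card_of_injOn (fun p => (p.2 - p.1, p.2)) ?_ ?_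
    · rintro ⟨b, y⟩ h
      simp only [coe_sigma, Set.mem_sigma_iff, mem_coe, mem_inter, mem_image] at h
      obtain ⟨-, ⟨x, hx, rfl⟩, hy⟩ := h
      simpa using ⟨hx, hy⟩
    · rintro ⟨b, y⟩ - ⟨b', y'⟩ - h
      simp only [Prod.mk.injEq] at h
      obtain ⟨h1, rfl⟩ := h
      have : b = b' := by simpa using h1
      subst this; rfl
  have h2 : P.card * X.card ≤ ∑ b ∈ P, ((X.image (· + b) ∩ X).card + g) := by
    rw [← smul_eq_mul, ← sum_const]
    refine sum_le_sum fun b hb => ?_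
    have := card_inter_add_shiftGain X b
    have := hg b hb
    omega
  rw [sum_add_distrib, sum_const, smul_eq_mul] at h2
  omega

/-- The iterated sumsets of a symmetric generating set grow at least linearly. -/
lemma card_nsmul_of_symmetric_generating [Fintype G] {R : Finset G} (h0 : 0 ∈ R)
    (hneg : ∀ x ∈ R, -x ∈ R)
    (hgen : ∀ T : Finset G, T.Nonempty → (∀ y ∈ T, ∀ x ∈ R, y + x ∈ T) → T = univ) (i : ℕ) :
    (i + 1) * R.card ≤ ((3 * i + 1) • R).card ∨ (3 * i + 1) • R = univ := by
  induction i with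
  | zero => simp
  | succ i ih =>
    have hmono : ∀ {j k : ℕ}, j ≤ k → j • R ⊆ k • R := fun h => nsmul_subset_nsmul_right h0 h
    -- Either the sumsets have stabilised, and generation gives everything, or there is a new point
    -- x. By symmetry of R the translate R + x then misses the (3i+1)-fold sumset, so three steps
    -- gain a full copy of R.
    by_cases hst : (3 * i + 3) • R ⊆ (3 * i + 2) • R
    · right
      have : (3 * i + 2) • R = univ := by
        refine hgen _ ⟨0, ?_⟩ fun y hy x hx => hst ?_
        · exact hmono (Nat.zero_le _) (by simp)
        · rw [show 3 * i + 3 = (3 * i + 2) + 1 by ring, succ_nsmul]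
          exact add_mem_add hy hx
      rw [← univ_subset_iff, ← this]
      exact hmono (by omega)
    · obtain ⟨x, hx, hx'⟩ := not_subset.1 hst
      rcases ih with ih | ih
      · left
        have hdis : Disjoint ((3 * i + 1) • R) (R.image (· + x)) := by
          rw [disjoint_right]
          intro y hy hy'
          obtain ⟨r, hr, rfl⟩ := mem_image.1 hy
          apply hx'
          rw [show 3 * i + 2 = (3 * i + 1) + 1 by ring, succ_nsmul]
          have := add_mem_add hy' (hneg r hr)
          rwa [add_comm r x, add_neg_cancel_right] at this
        have hsub : (3 * i + 1) • R ∪ R.image (· + x) ⊆ (3 * (i + 1) + 1) • R := by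
          refine union_subset (hmono (by omega)) ?_
          intro y hy
          obtain ⟨r, hr, rfl⟩ := mem_image.1 hy
          rw [show 3 * (i + 1) + 1 = (3 * i + 3) + 1 by ring, succ_nsmul, add_comm r x]
          exact add_mem_add hx hr
        have := card_le_card hsub
        rw [card_union_of_disjoint hdis, card_image_add_right] at this
        linarith
      · right
        rw [← univ_subset_iff, ← ih]
        exact hmono (by omega)

end ShiftGain

/-! ### Signed sumsets of a set of integers -/

/-- A nonempty subset of `ZMod M` that is stable under translation by a set of naturals with no
common factor with `M` is everything. -/
lemma zmod_eq_univ_of_stable {M : ℕ} [NeZero M] {T : Finset (ZMod M)} (hT : T.Nonempty)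
    {B : Finset ℕ} (hgcd : ∀ p, 2 ≤ p → p ∣ M → ∃ x ∈ B, ¬ p ∣ x)
    (h : ∀ y ∈ T, ∀ x ∈ B, y + (x : ZMod M) ∈ T) : T = univ := by
  -- The integer translations preserving T form a subgroup eℤ; closure under negation uses that T is
  -- finite. Here e divides M and all of B, so the gcd hypothesis makes e a unit.
  let S : AddSubgroup ℤ :=
    { carrier := {z | ∀ y ∈ T, y + (z : ZMod M) ∈ T}
      zero_mem' := by intro y hy; simpa using hy
      add_mem' := by
        intro a b ha hb y hy
        have := hb _ (ha y hy)
        rwa [add_assoc, ← Int.cast_add] at this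
      neg_mem' := by
        intro a ha y hy
        have h1 : T.image (· + (a : ZMod M)) = T := by
          refine eq_of_subset_of_card_le ?_ (by rw [card_image_add_right])
          intro z hz
          obtain ⟨x, hx, rfl⟩ := mem_image.1 hz
          exact ha x hx
        rw [← h1] at hy
        obtain ⟨x, hx, rfl⟩ := mem_image.1 hy
        simpa using hx }
  obtain ⟨e, he⟩ := Int.subgroup_cyclic S
  have hmem : ∀ z : ℤ, z ∈ S ↔ e ∣ z := by
    intro z
    rw [he, ← AddSubgroup.zmultiples_eq_closure, Int.mem_zmultiples_iff]
  have hM : e ∣ (M : ℤ) := by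
    rw [← hmem]
    intro y hy
    simpa using hy
  have hB : ∀ x ∈ B, e ∣ (x : ℤ) := by
    intro x hx
    rw [← hmem]
    intro y hy
    simpa using h y hy x hx
  have h1 : (1 : ℤ) ∈ S := by
    rw [hmem]
    by_contra hcon
    have hM' : e.natAbs ∣ M := Int.natAbs_dvd_natAbs.2 hM
    have hpos : e.natAbs ≠ 0 := fun h0 => NeZero.ne M (by simpa [h0] using hM')
    have hne : e.natAbs ≠ 1 := by
      intro h1
      exact hcon (Int.isUnit_iff_natAbs_eq.2 h1).dvd
    obtain ⟨x, hx, hxe⟩ := hgcd e.natAbs (by omega) hM'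
    exact hxe (Int.natAbs_dvd_natAbs.2 (hB x hx))
  obtain ⟨y, hy⟩ := hT
  rw [eq_univ_iff_forall]
  intro z
  have h2 : ((z - y).val : ℤ) ∈ S := by
    rw [hmem]; exact ((hmem 1).1 h1).trans (one_dvd _)
  have := h2 y hy
  simpa using this

/-- The image of `{0} ∪ B ∪ -B` in the ring `R`. -/
def signedSet (R : Type*) [CommRing R] [DecidableEq R] (B : Finset ℕ) : Finset R :=
  insert 0 (B.image (fun x : ℕ => (x : R)) ∪ B.image (fun x : ℕ => -(x : R)))

section SignedSet

variable {R : Type*} [CommRing R] [DecidableEq R]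

lemma mem_signedSet {B : Finset ℕ} {y : R} :
    y ∈ signedSet R B ↔ y = 0 ∨ (∃ x ∈ B, (x : R) = y) ∨ ∃ x ∈ B, -(x : R) = y := by
  simp [signedSet]

lemma zero_mem_signedSet (B : Finset ℕ) : (0 : R) ∈ signedSet R B := by simp [mem_signedSet]

lemma cast_mem_signedSet {B : Finset ℕ} {x : ℕ} (hx : x ∈ B) : (x : R) ∈ signedSet R B :=
  mem_signedSet.2 (Or.inr (Or.inl ⟨x, hx, rfl⟩))

lemma neg_mem_signedSet {B : Finset ℕ} {y : R} (hy : y ∈ signedSet R B) :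
    -y ∈ signedSet R B := by
  rw [mem_signedSet] at hy ⊢
  rcases hy with rfl | ⟨x, hx, rfl⟩ | ⟨x, hx, rfl⟩
  · simp
  · exact Or.inr (Or.inr ⟨x, hx, rfl⟩)
  · exact Or.inr (Or.inl ⟨x, hx, by simp⟩)

lemma shiftGain_signedSet_le {X : Finset R} {B : Finset ℕ} {g : ℕ}
    (hg : ∀ x ∈ B, shiftGain X (x : R) ≤ g) : ∀ b ∈ signedSet R B, shiftGain X b ≤ g := by
  intro b hb
  rcases mem_signedSet.1 hb with rfl | ⟨x, hx, rfl⟩ | ⟨x, hx, rfl⟩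
  · simp [shiftGain_zero]
  · exact hg x hx
  · rw [shiftGain_neg]; exact hg x hx

lemma neg_mem_nsmul_signedSet {B : Finset ℕ} (j : ℕ) {y : R} (hy : y ∈ j • signedSet R B) :
    -y ∈ j • signedSet R B := by
  induction j generalizing y with
  | zero => simpa using hy
  | succ j ih =>
    rw [succ_nsmul, mem_add] at hy ⊢
    obtain ⟨a, ha, b, hb, rfl⟩ := hy
    exact ⟨-a, ih ha, -b, neg_mem_signedSet hb, by ring⟩

lemma natCast_mul_mem_nsmul_signedSet {B : Finset ℕ} {a : ℕ} (ha : a ∈ B) {k l : ℕ}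
    (hkl : k ≤ l) : (k : R) * a ∈ l • signedSet R B := by
  refine nsmul_subset_nsmul_right (zero_mem_signedSet B) hkl ?_
  have := nsmul_mem_nsmul (n := k) (cast_mem_signedSet (R := R) ha)
  rwa [nsmul_eq_mul] at this

lemma image_nsmul_signedSet (M : ℕ) (B : Finset ℕ) (j : ℕ) :
    (j • signedSet ℤ B).image (Int.cast : ℤ → ZMod M) = j • signedSet (ZMod M) B := by
  have h1 : (signedSet ℤ B).image (Int.cast : ℤ → ZMod M) = signedSet (ZMod M) B := by
    simp [signedSet, image_insert, image_union, image_image, Function.comp_def]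
  rw [← h1]
  exact image_nsmul (Int.castAddHom (ZMod M)) _ _

lemma abs_le_of_mem_nsmul_signedSet {B : Finset ℕ} {n : ℕ} (hB : ∀ x ∈ B, x ≤ n) (j : ℕ) :
    ∀ y ∈ j • signedSet ℤ B, |y| ≤ j * n := by
  induction j with
  | zero => intro y hy; simp at hy; simp [hy]
  | succ j ih =>
    intro y hy
    rw [succ_nsmul, mem_add] at hy
    obtain ⟨a, ha, b, hb, rfl⟩ := hy
    have h1 := ih a ha
    have h2 : |b| ≤ n := by
      rcases mem_signedSet.1 hb with rfl | ⟨x, hx, rfl⟩ | ⟨x, hx, rfl⟩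
      · simp
      · simpa using hB x hx
      · simpa using hB x hx
    have h3 := abs_add_le a b
    push_cast
    linarith

lemma signedSet_generates {M : ℕ} [NeZero M] {B : Finset ℕ}
    (hgcd : ∀ p, 2 ≤ p → ∃ x ∈ B, ¬ p ∣ x) {l : ℕ} (hl : 1 ≤ l) (T : Finset (ZMod M))
    (hT : T.Nonempty) (h : ∀ y ∈ T, ∀ x ∈ l • signedSet (ZMod M) B, y + x ∈ T) : T = univ := by
  refine zmod_eq_univ_of_stable hT (fun p hp _ => hgcd p hp) fun y hy x hx => h y hy _ ?_
  refine nsmul_subset_nsmul_right (zero_mem_signedSet B) hl ?_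
  simpa using cast_mem_signedSet hx

/-- Quadratic growth of the iterated sumsets of `{0} ∪ B ∪ -B`, for a set `B` of positive integers
with greatest common divisor one. -/
lemma card_nsmul_signedSet {B : Finset ℕ} {a u μ : ℕ} (ha : a ∈ B)
    (hB : ∀ x ∈ B, 1 ≤ x ∧ x ≤ a) (hgcd : ∀ p, 2 ≤ p → ∃ x ∈ B, ¬ p ∣ x) (hu : 1 ≤ u)
    (hμ : μ ≤ B.card) (hua : u * μ ≤ a) :
    3 * u * (u * μ) ≤ ((6 * u) • signedSet ℤ B).card := by
  have ha1 := (hB a ha).1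
  have : NeZero a := ⟨by omega⟩
  obtain ⟨i, rfl⟩ : ∃ i, u = i + 1 := ⟨u - 1, by omega⟩
  set R := signedSet (ZMod a) B with hR
  have hRcard : μ ≤ R.card := by
    refine hμ.trans ?_
    refine card_le_card_of_injOn (fun x : ℕ => (x : ZMod a))
      (fun x hx => cast_mem_signedSet hx) ?_
    intro x hx y hy hxy
    have h1 := hB x hx
    have h2 := hB y hy
    have h3 : x ≡ y [MOD a] := (ZMod.natCast_eq_natCast_iff _ _ _).1 hxy
    rcases le_total x y with h | h
    · have h4 := (Nat.modEq_iff_dvd' h).1 h3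
      have := Nat.eq_zero_of_dvd_of_lt h4 (by omega)
      omega
    · have h4 := (Nat.modEq_iff_dvd' h).1 h3.symm
      have := Nat.eq_zero_of_dvd_of_lt h4 (by omega)
      omega
  have hlayer : (i + 1) * μ ≤ ((3 * i + 1) • R).card := by
    rcases card_nsmul_of_symmetric_generating (R := R) (zero_mem_signedSet B)
      (fun x hx => neg_mem_signedSet hx)
      (fun T hT h => signedSet_generates hgcd le_rfl T hT (by simpa using h)) i with h | h
    · exact (Nat.mul_le_mul_left _ hRcard).trans h
    · rw [h, card_univ, ZMod.card]; exact hua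
  have hsec : ∀ ρ ∈ (3 * i + 1) • R, ∃ z ∈ (3 * i + 1) • signedSet ℤ B, ((z : ℤ) : ZMod a) = ρ := by
    intro ρ hρ
    rw [hR, ← image_nsmul_signedSet] at hρ
    simpa using hρ
  choose! f hf hfc using hsec
  -- Quadratic growth is linear growth in two directions: the residues modulo a, lifted to integers,
  -- and the multiples of a added to each lift. The summands used number at most (3i+1) + (3i+4) ≤
  -- 6(i+1).
  have hcount : (((3 * i + 1) • R) ×ˢ range (3 * i + 5)).card ≤
      ((6 * (i + 1)) • signedSet ℤ B).card := by
    refine card_le_card_of_injOn (fun p => f p.1 + (p.2 : ℤ) * a) ?_ ?_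
    · rintro ⟨ρ, k⟩ h
      simp only [coe_product, Set.mem_prod, mem_coe, mem_range] at h
      have := add_mem_add (hf ρ h.1)
        (natCast_mul_mem_nsmul_signedSet (R := ℤ) ha (k := k) (l := 3 * i + 4) (by omega))
      rw [← add_nsmul] at this
      exact nsmul_subset_nsmul_right (zero_mem_signedSet B) (by omega) this
    · rintro ⟨ρ, k⟩ h ⟨ρ', k'⟩ h' heq
      simp only [coe_product, Set.mem_prod, mem_coe, mem_range] at h h' heq
      have h1 : ρ = ρ' := by
        have := congrArg (Int.cast : ℤ → ZMod a) heq
        simpa [hfc ρ h.1, hfc ρ' h'.1] using this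
      subst h1
      have h2 : (k : ℤ) * a = k' * a := by linarith
      have h3 : (k : ℤ) = k' := by
        refine mul_right_cancel₀ ?_ h2
        exact_mod_cast (NeZero.ne a)
      have : k = k' := by exact_mod_cast h3
      rw [this]
  rw [card_product, card_range] at hcount
  calc 3 * (i + 1) * ((i + 1) * μ) ≤ (3 * i + 5) * ((3 * i + 1) • R).card :=
        Nat.mul_le_mul (by omega) hlayer
    _ ≤ _ := by rw [mul_comm]; exact hcount

end SignedSet

/-! ### Elements with large gain -/

/-- If `X` is not too large, some element of `B` moves a large part of `X` outside `X`. -/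
lemma exists_large_shiftGain {B : Finset ℕ} {a u μ : ℕ} (ha : a ∈ B)
    (hB : ∀ x ∈ B, 1 ≤ x ∧ x ≤ a) (hgcd : ∀ p, 2 ≤ p → ∃ x ∈ B, ¬ p ∣ x) (hu : 1 ≤ u)
    (hμ : μ ≤ B.card) (hua : u * μ ≤ a) {X : Finset ℤ} (hX : X.card < u * u * μ) :
    ∃ x ∈ B, X.card ≤ 12 * u * shiftGain X (x : ℤ) := by
  by_contra! hcon
  rcases Nat.eq_zero_or_pos X.card with h0 | hpos
  · have := hcon a ha; omega
  set g := (X.card - 1) / (12 * u) with hgdef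
  have hg : ∀ x ∈ B, shiftGain X (x : ℤ) ≤ g := by
    intro x hx
    rw [hgdef, Nat.le_div_iff_mul_le (by omega)]
    have := hcon x hx
    rw [mul_comm]; omega
  have hg2 : 12 * u * g ≤ X.card := (Nat.mul_div_le _ _).trans (Nat.sub_le _ _)
  -- All shifts in the 6u-fold sumset have gain at most 6ug ≤ |X|/2, so there are at most 2|X| of
  -- them. This contradicts the lower bound 3u²μ.
  have h1 := card_mul_card_le_of_shiftGain_le
    (shiftGain_le_of_mem_nsmul (shiftGain_signedSet_le hg) (6 * u))
  have h2 := card_nsmul_signedSet ha hB hgcd hu hμ hua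
  set P := ((6 * u) • signedSet ℤ B).card
  have h3 : P ≤ 2 * X.card := by
    by_contra! hlt
    nlinarith
  nlinarith

/-- The modular analogue, when the iterated sumset is everything. -/
lemma exists_large_shiftGain_zmod {M : ℕ} [NeZero M] {B : Finset ℕ} {J : ℕ} (hJ : 1 ≤ J)
    (hBne : B.Nonempty) (hcover : J • signedSet (ZMod M) B = univ) {Y : Finset (ZMod M)}
    (hY : 2 * Y.card ≤ M) : ∃ x ∈ B, Y.card ≤ 2 * J * shiftGain Y (x : ZMod M) := by
  by_contra! hcon
  rcases Nat.eq_zero_or_pos Y.card with h0 | hpos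
  · obtain ⟨a, ha⟩ := hBne
    have := hcon a ha; omega
  set g := (Y.card - 1) / (2 * J) with hgdef
  have hg : ∀ x ∈ B, shiftGain Y (x : ZMod M) ≤ g := by
    intro x hx
    rw [hgdef, Nat.le_div_iff_mul_le (by omega)]
    have := hcon x hx
    rw [mul_comm]; omega
  have hg2 : 2 * J * g + 1 ≤ Y.card := by
    have := Nat.mul_div_le (Y.card - 1) (2 * J)
    rw [← hgdef] at this
    omega
  have h1 := card_mul_card_le_of_shiftGain_le
    (shiftGain_le_of_mem_nsmul (shiftGain_signedSet_le hg) J)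
  rw [hcover, card_univ, ZMod.card] at h1
  have hM : 0 < M := Nat.pos_of_ne_zero (NeZero.ne M)
  nlinarith

/-! ### Sets of subset sums and how to enlarge them -/

/-- Every element of `X` is the image of a sum of at most `h` distinct elements of `V`. -/
def IsSubsetSums {R : Type*} [CommRing R] (V : Finset ℕ) (h : ℕ) (X : Finset R) : Prop :=
  ∀ x ∈ X, ∃ S ⊆ V, S.card ≤ h ∧ ((∑ i ∈ S, i : ℕ) : R) = x

section SubsetSums

variable {R : Type*} [CommRing R] [DecidableEq R]

lemma IsSubsetSums.add {V V' : Finset ℕ} {h h' : ℕ} {X X' : Finset R}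
    (hX : IsSubsetSums V h X) (hX' : IsSubsetSums V' h' X') (hd : Disjoint V V') :
    IsSubsetSums (V ∪ V') (h + h') (X + X') := by
  intro z hz
  obtain ⟨x, hx, y, hy, rfl⟩ := mem_add.1 hz
  obtain ⟨S, hS, hSc, rfl⟩ := hX x hx
  obtain ⟨S', hS', hSc', rfl⟩ := hX' y hy
  have hdS : Disjoint S S' := disjoint_of_subset_left hS (disjoint_of_subset_right hS' hd)
  refine ⟨S ∪ S', union_subset_union hS hS', ?_, ?_⟩
  · rw [card_union_of_disjoint hdS]; omega
  · rw [sum_union hdS]; push_cast; rfl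

lemma IsSubsetSums.union_translate {V : Finset ℕ} {h : ℕ} {X : Finset R}
    (hX : IsSubsetSums V h X) {a : ℕ} (ha : a ∉ V) :
    IsSubsetSums (insert a V) (h + 1) (X ∪ X.image (· + (a : R))) := by
  intro z hz
  rcases mem_union.1 hz with hz | hz
  · obtain ⟨S, hS, hSc, rfl⟩ := hX z hz
    exact ⟨S, hS.trans (subset_insert _ _), by omega, rfl⟩
  · obtain ⟨x, hx, rfl⟩ := mem_image.1 hz
    obtain ⟨S, hS, hSc, rfl⟩ := hX x hx
    have haS : a ∉ S := fun h => ha (hS h)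
    refine ⟨insert a S, insert_subset_insert _ hS, ?_, ?_⟩
    · rw [card_insert_of_notMem haS]; omega
    · rw [sum_insert haS]; push_cast; ring

lemma isSubsetSums_image_cast (V : Finset ℕ) :
    IsSubsetSums V 1 (V.image (fun x : ℕ => (x : R))) := by
  intro z hz
  obtain ⟨x, hx, rfl⟩ := mem_image.1 hz
  exact ⟨{x}, by simpa using hx, by simp, by simp⟩

lemma IsSubsetSums.image_intCast {V : Finset ℕ} {h : ℕ} {X : Finset ℤ}
    (hX : IsSubsetSums V h X) (M : ℕ) :
    IsSubsetSums V h (X.image (Int.cast : ℤ → ZMod M)) := by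
  intro z hz
  obtain ⟨x, hx, rfl⟩ := mem_image.1 hz
  obtain ⟨S, hS, hSc, rfl⟩ := hX x hx
  exact ⟨S, hS, hSc, by push_cast; rfl⟩

lemma IsSubsetSums.mem_Icc {V : Finset ℕ} {h n : ℕ} {X : Finset ℤ}
    (hX : IsSubsetSums V h X) (hV : ∀ x ∈ V, x ≤ n) : ∀ x ∈ X, 0 ≤ x ∧ x ≤ h * n := by
  intro x hx
  obtain ⟨S, hS, hSc, rfl⟩ := hX x hx
  refine ⟨Int.natCast_nonneg _, ?_⟩
  have h1 : ∑ i ∈ S, i ≤ S.card * n := by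
    rw [← smul_eq_mul]; exact sum_le_card_nsmul _ _ _ fun i hi => hV i (hS hi)
  have h2 : ∑ i ∈ S, i ≤ h * n := h1.trans (Nat.mul_le_mul_right _ hSc)
  exact_mod_cast h2

/-- Repeated addition of well-chosen single elements. -/
lemma IsSubsetSums.grow {A W : Finset ℕ} {w lo hi g : ℕ}
    (hgain : ∀ V : Finset ℕ, V.card ≤ w → ∀ X : Finset R, lo ≤ X.card → X.card < hi →
      ∃ a ∈ A \ V, g ≤ shiftGain X (a : R))
    {V : Finset ℕ} {h : ℕ} {X : Finset R} (hX : IsSubsetSums V h X) (hV : V ⊆ A \ W)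
    (hlo : lo ≤ X.card) (s : ℕ) (hw : W.card + V.card + s ≤ w) :
    ∃ V' ⊆ A \ W, ∃ X' : Finset R, IsSubsetSums V' (h + s) X' ∧ V'.card ≤ V.card + s ∧
      min hi (lo + s * g) ≤ X'.card ∧ lo ≤ X'.card := by
  induction s with
  | zero => exact ⟨V, hV, X, hX, le_rfl, by simp [hlo], hlo⟩
  | succ s ih =>
    obtain ⟨V', hV', X', hX', hVc, hXc, hXlo⟩ := ih (by omega)
    rcases le_or_gt hi X'.card with hhi | hhi
    · refine ⟨V', hV', X', ?_, by omega, (min_le_left _ _).trans hhi, hXlo⟩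
      intro x hx
      obtain ⟨S, hS, hSc, hSx⟩ := hX' x hx
      exact ⟨S, hS, by omega, hSx⟩
    -- Excluding both the reserved set W and the elements already spent keeps the summands distinct.
    · obtain ⟨a, ha, hag⟩ := hgain (W ∪ V') ((card_union_le _ _).trans (by omega)) X' hXlo hhi
      rw [mem_sdiff, mem_union, not_or] at ha
      refine ⟨insert a V', insert_subset (mem_sdiff.2 ⟨ha.1, ha.2.1⟩) hV',
        X' ∪ X'.image (· + (a : R)), hX'.union_translate ha.2.2, ?_, ?_, ?_⟩
      · rw [card_insert_of_notMem ha.2.2]; omega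
      · rw [card_union_image_add]
        have : lo + s * g ≤ X'.card := by
          rcases min_le_iff.1 hXc with h | h <;> omega
        refine (min_le_right _ _).trans ?_
        rw [add_mul]; omega
      · rw [card_union_image_add]; omega

/-- Adding a suitable small subset of a set `B` to `X` gives many sums. -/
lemma exists_add_image_card {A X : Finset ℕ} {W : Finset ℕ} {μ w : ℕ}
    (hA : ∀ V : Finset ℕ, V.card ≤ w → μ ≤ (A \ V).card) (s : ℕ) (hw : W.card + s ≤ w) :
    ∃ V ⊆ A \ W, V.card ≤ s ∧ min μ (s * X.card) ≤ 2 * (X + V).card := by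
  induction s with
  | zero => exact ⟨∅, by simp, by simp, by simp⟩
  | succ s ih =>
    obtain ⟨V, hV, hVc, hc⟩ := ih (by omega)
    rcases le_or_gt μ (2 * (X + V).card) with hμ | hμ
    · exact ⟨V, hV, by omega, (min_le_left _ _).trans hμ⟩
    · have hB := hA (W ∪ V) ((card_union_le _ _).trans (by omega))
      have hsum : ∑ a ∈ A \ (W ∪ V), (X.image (· + a) ∩ (X + V)).card ≤
          X.card * (X + V).card := by
        rw [← card_sigma, ← card_product]
        refine card_le_card_of_injOn (fun p => (p.2 - p.1, p.2)) ?_ ?_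
        · rintro ⟨b, y⟩ h
          simp only [coe_sigma, Set.mem_sigma_iff, mem_coe, mem_inter, mem_image] at h
          obtain ⟨-, ⟨x, hx, rfl⟩, hy⟩ := h
          exact mem_coe.2 (mem_product.2 ⟨by simpa using hx, hy⟩)
        · rintro ⟨b, y⟩ h1 ⟨b', y'⟩ h2 h
          simp only [coe_sigma, Set.mem_sigma_iff, mem_coe, mem_inter, mem_image] at h1 h2
          simp only [Prod.mk.injEq] at h
          obtain ⟨h, rfl⟩ := h
          obtain ⟨-, ⟨x, hx, hxb⟩, -⟩ := h1
          obtain ⟨-, ⟨x', hx', hxb'⟩, -⟩ := h2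
          have : b = b' := by omega
          subst this; rfl
      have hBne : 0 < (A \ (W ∪ V)).card := by omega
      -- With |X + V| < μ/2 and at least μ candidates, the average overlap is below |X|/2. Some a
      -- therefore adds at least |X|/2 new sums.
      obtain ⟨a, ha, hai⟩ : ∃ a ∈ A \ (W ∪ V), 2 * (X.image (· + a) ∩ (X + V)).card ≤ X.card := by
        by_contra! hcon
        have h1 : (A \ (W ∪ V)).card * (X.card + 1) ≤
            ∑ a ∈ A \ (W ∪ V), 2 * (X.image (· + a) ∩ (X + V)).card := by
          rw [← smul_eq_mul]
          exact card_nsmul_le_sum _ _ _ fun a ha => hcon a ha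
        rw [← mul_sum] at h1
        nlinarith
      rw [mem_sdiff, mem_union, not_or] at ha
      refine ⟨insert a V, insert_subset (mem_sdiff.2 ⟨ha.1, ha.2.1⟩) hV, ?_, ?_⟩
      · rw [card_insert_of_notMem ha.2.2]; omega
      · have h1 : (X + V) ∪ (X.image (· + a) \ (X + V)) ⊆ X + insert a V := by
          refine union_subset (add_subset_add_left (subset_insert _ _)) fun y hy => ?_
          obtain ⟨x, hx, rfl⟩ := mem_image.1 (mem_sdiff.1 hy).1
          exact add_mem_add hx (mem_insert_self _ _)
        have h2 := card_le_card h1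
        rw [card_union_of_disjoint disjoint_sdiff] at h2
        have h3 := card_inter_add_card_sdiff (X.image (· + a)) (X + V)
        rw [card_image_of_injective _ (add_left_injective a)] at h3
        rw [add_mul, one_mul]
        omega

end SubsetSums

/-! ### Robust sets and their many short sums -/

/-- After the removal of at most `w` elements, the subset `A` of `[1, n]` still has at least `μ`
elements, a maximum larger than `n / 2`, and greatest common divisor one. -/
structure RobustSet (A : Finset ℕ) (n μ w : ℕ) : Prop where
  mem_Icc : ∀ x ∈ A, 1 ≤ x ∧ x ≤ n
  card_le : ∀ W : Finset ℕ, W.card ≤ w → μ ≤ (A \ W).card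
  exists_large : ∀ W : Finset ℕ, W.card ≤ w → ∃ x ∈ A \ W, n < 2 * x
  exists_not_dvd : ∀ W : Finset ℕ, W.card ≤ w → ∀ p, 2 ≤ p → ∃ x ∈ A \ W, ¬ p ∣ x

section Robust

variable {A : Finset ℕ} {n μ w : ℕ}

/-- The largest surviving element a exceeds n/2 ≥ uμ, so `exists_large_shiftGain` applies to what
remains after deleting W. -/
lemma RobustSet.exists_shiftGain (hA : RobustSet A n μ w) {W : Finset ℕ} (hW : W.card ≤ w)
    {u : ℕ} (hu : 1 ≤ u) (hun : 2 * (u * μ) ≤ n) {X : Finset ℤ} (hX : X.card < u * u * μ) :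
    ∃ a ∈ A \ W, X.card ≤ 12 * u * shiftGain X (a : ℤ) := by
  obtain ⟨b, hb, hbn⟩ := hA.exists_large W hW
  obtain ⟨a, ha, hmax⟩ := exists_max_image (A \ W) id ⟨b, hb⟩
  have hba : b ≤ a := hmax b hb
  exact exists_large_shiftGain ha
    (fun x hx => ⟨(hA.mem_Icc x (mem_sdiff.1 hx).1).1, hmax x hx⟩)
    (hA.exists_not_dvd W hW) hu (hA.card_le W hW) (by omega) hX

/-- A robust set has many sums of about `100 u` of its elements. -/
lemma RobustSet.exists_many_sums (hA : RobustSet A n μ w) {v : ℕ} (hv : μ ≤ v * v)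
    (hvμ : v ≤ μ) (hμ : 10 ^ 6 ≤ μ) {W : Finset ℕ} (u : ℕ) (hu : 1 ≤ u) (hun : 2 * (u * μ) ≤ n)
    (hw : W.card + (2 * v + 100 * u) ≤ w) :
    ∃ V ⊆ A \ W, ∃ X : Finset ℤ, IsSubsetSums V (100 * u + 2) X ∧
      V.card ≤ 2 * v + 100 * u ∧ u * u * μ ≤ X.card := by
  induction u, hu using Nat.le_induction with
  | base =>
    -- Two sets of about √μ elements already give μ/2 two-term sums; 100 single additions, each
    -- gaining at least μ/24, raise this to μ.
    obtain ⟨V₁, hV₁, hV₁c⟩ := exists_subset_card_eq (hvμ.trans (hA.card_le W (by omega)))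
    obtain ⟨V₂, hV₂, hV₂c, hc⟩ := exists_add_image_card (X := V₁) (W := W ∪ V₁)
      hA.card_le v ((Nat.add_le_add_right (card_union_le _ _) _).trans (by omega))
    have hd : Disjoint V₁ V₂ := by
      rw [disjoint_right]
      intro x hx hx'
      exact (mem_sdiff.1 (hV₂ hx)).2 (mem_union_right _ hx')
    have hV : V₁ ∪ V₂ ⊆ A \ W := by
      refine union_subset hV₁ fun x hx => ?_
      have := mem_sdiff.1 (hV₂ hx)
      exact mem_sdiff.2 ⟨this.1, fun h => this.2 (mem_union_left _ h)⟩
    have hX := (isSubsetSums_image_cast (R := ℤ) V₁).add (isSubsetSums_image_cast V₂) hd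
    have hXc : μ ≤ 2 * (V₁.image (fun x : ℕ => (x : ℤ)) + V₂.image (fun x : ℕ => (x : ℤ))).card := by
      have h1 : V₁.image (fun x : ℕ => (x : ℤ)) + V₂.image (fun x : ℕ => (x : ℤ)) =
          (V₁ + V₂).image (fun x : ℕ => (x : ℤ)) := (image_add (Nat.castAddMonoidHom ℤ)).symm
      rw [h1, card_image_of_injective _ Nat.cast_injective]
      rw [hV₁c] at hc
      rcases min_le_iff.1 hc with h | h <;> omega
    have hVc : (V₁ ∪ V₂).card ≤ 2 * v := (card_union_le _ _).trans (by omega)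
    obtain ⟨V', hV', X', hX', hVc', hXc', -⟩ := hX.grow (A := A) (W := W) (w := w)
      (lo := (μ + 1) / 2) (hi := μ) (g := μ / 24) (fun V hV X hlo hhi => by
        obtain ⟨a, ha, hag⟩ := hA.exists_shiftGain hV (u := 1) le_rfl hun (X := X) (by omega)
        exact ⟨a, ha, by omega⟩) hV (by omega) 100 (by omega)
    refine ⟨V', hV', X', fun x hx => ?_, by omega, by omega⟩
    obtain ⟨S, hS, hSc, hSx⟩ := hX' x hx
    exact ⟨S, hS, by omega, hSx⟩
  | succ u hu ih =>
    obtain ⟨V, hV, X, hX, hVc, hXc⟩ := ih (by nlinarith) (by omega)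
    have hbig : 10 ^ 6 ≤ u * μ := by nlinarith
    -- Passing from u²μ to (u+1)²μ requires (2u+1)μ ≤ 3uμ new sums, and each addition gains at least
    -- about uμ/24, so 100 additions suffice.
    obtain ⟨V', hV', X', hX', hVc', hXc', -⟩ := hX.grow (A := A) (W := W) (w := w)
      (lo := u * u * μ) (hi := (u + 1) * (u + 1) * μ) (g := u * μ / 24)
      (fun V hV X hlo hhi => by
        obtain ⟨a, ha, hag⟩ := hA.exists_shiftGain hV (u := u + 1) (by omega) hun (X := X) hhi
        refine ⟨a, ha, ?_⟩
        have h1 : u * (u * μ) ≤ u * (24 * shiftGain X (a : ℤ)) := by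
          calc u * (u * μ) = u * u * μ := by ring
            _ ≤ 12 * (u + 1) * shiftGain X (a : ℤ) := hlo.trans hag
            _ ≤ 12 * (u + u) * shiftGain X (a : ℤ) := by gcongr
            _ = _ := by ring
        have h2 := Nat.le_of_mul_le_mul_left h1 (by omega)
        omega) hV hXc 100 (by omega)
    refine ⟨V', hV', X', ?_, by omega, ?_⟩
    · rwa [show 100 * (u + 1) + 2 = 100 * u + 2 + 100 by ring]
    · refine le_trans (le_min le_rfl ?_) hXc'
      have h3 : 3 * (u * μ) ≤ 100 * (u * μ / 24) := by omega
      have h4 : μ ≤ u * μ := Nat.le_mul_of_pos_left _ hu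
      have h5 : (u + 1) * (u + 1) * μ = u * u * μ + 2 * (u * μ) + μ := by ring
      omega

end Robust

/-! ### Residues, common differences and progressions -/

lemma IsSubsetSums.mono {R : Type*} [CommRing R] {V V' : Finset ℕ} {h h' : ℕ} {X : Finset R}
    (hX : IsSubsetSums V h X) (hV : V ⊆ V') (hh : h ≤ h') : IsSubsetSums V' h' X := by
  intro x hx
  obtain ⟨S, hS, hSc, hSx⟩ := hX x hx
  exact ⟨S, hS.trans hV, hSc.trans hh, hSx⟩

/-- A set of integers in an interval of length `ℓ` has many residues modulo `M`. -/
lemma mul_card_le_card_image_zmod {M : ℕ} [NeZero M] {S : Finset ℤ} {lo : ℤ} {ℓ : ℕ}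
    (hS : ∀ x ∈ S, lo ≤ x ∧ x ≤ lo + ℓ) :
    M * S.card ≤ (S.image (Int.cast : ℤ → ZMod M)).card * (ℓ + M) := by
  have hM : 0 < M := Nat.pos_of_ne_zero (NeZero.ne M)
  have hMz : (0 : ℤ) < M := by exact_mod_cast hM
  have hfib : ∀ ρ ∈ S.image (Int.cast : ℤ → ZMod M),
      (S.filter (fun x : ℤ => (x : ZMod M) = ρ)).card ≤ ℓ / M + 1 := by
    intro ρ _
    rw [← card_range (ℓ / M + 1)]
    refine card_le_card_of_injOn (fun x => ((x - lo) / M).toNat) ?_ ?_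
    · intro x hx
      have hx := hS x (mem_filter.1 hx).1
      simp only [coe_range, Set.mem_Iio]
      have h1 : (x - lo) / M ≤ (ℓ : ℤ) / M := Int.ediv_le_ediv hMz (by linarith)
      have h2 : ((ℓ / M : ℕ) : ℤ) = (ℓ : ℤ) / M := by push_cast; rfl
      have h3 : 0 ≤ (x - lo) / M := Int.ediv_nonneg (by linarith) hMz.le
      omega
    · intro x hx y hy hxy
      have hx1 := hS x (mem_filter.1 hx).1
      have hy1 := hS y (mem_filter.1 hy).1
      have hcast : (x : ZMod M) = y := (mem_filter.1 hx).2.trans (mem_filter.1 hy).2.symm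
      have hmod : (x - lo) % M = (y - lo) % M := by
        have : ((x - lo : ℤ) : ZMod M) = ((y - lo : ℤ) : ZMod M) := by push_cast; rw [hcast]
        exact (ZMod.intCast_eq_intCast_iff' _ _ _).1 this
      have h1 : 0 ≤ (x - lo) / M := Int.ediv_nonneg (by linarith) hMz.le
      have h2 : 0 ≤ (y - lo) / M := Int.ediv_nonneg (by linarith) hMz.le
      have h3 : (x - lo) / M = (y - lo) / M := by
        simp only at hxy
        omega
      have h4 := Int.emod_add_mul_ediv (x - lo) M
      have h5 := Int.emod_add_mul_ediv (y - lo) M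
      rw [h3, hmod] at h4
      linarith
  have h1 := card_le_mul_card_image S _ hfib
  have h2 : M * (ℓ / M + 1) ≤ ℓ + M := by
    have := Nat.mul_div_le ℓ M
    rw [mul_add]; omega
  calc M * S.card ≤ M * ((ℓ / M + 1) * (S.image (Int.cast : ℤ → ZMod M)).card) :=
        Nat.mul_le_mul_left _ h1
    _ = (S.image (Int.cast : ℤ → ZMod M)).card * (M * (ℓ / M + 1)) := by ring
    _ ≤ _ := Nat.mul_le_mul_left _ h2

/-- Most elements of a set of integers differ from the minimum by at least `lo`. -/
lemma card_le_card_large_differences {X : Finset ℤ} {lo hi : ℕ}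
    (hX : ∀ x ∈ X, 0 ≤ x ∧ x ≤ hi) :
    X.card ≤ ((Icc lo hi).filter (fun M : ℕ => ∃ x ∈ X, x + M ∈ X)).card + lo := by
  rcases X.eq_empty_or_nonempty with rfl | hne
  · simp
  obtain ⟨m, hm, hmin⟩ := exists_min_image X id hne
  simp only [id] at hmin
  have h1 : X.card ≤ ((Icc lo hi).filter (fun M : ℕ => ∃ x ∈ X, x + M ∈ X) ∪ range lo).card := by
    refine card_le_card_of_injOn (fun x => (x - m).toNat) ?_ ?_
    · intro x hx
      have hx1 := hX x hx
      have hx2 := hmin x hx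
      have hm1 := hX m hm
      simp only [coe_union, Set.mem_union, mem_coe, mem_range, mem_filter, mem_Icc]
      rcases lt_or_ge (x - m).toNat lo with h | h
      · exact Or.inr h
      · refine Or.inl ⟨⟨h, by omega⟩, m, hm, ?_⟩
        rw [Int.toNat_of_nonneg (by omega)]
        simpa using hx
    · intro x hx y hy hxy
      have hx2 := hmin x hx
      have hy2 := hmin y hy
      simp only at hxy
      omega
  refine h1.trans ((card_union_le _ _).trans ?_)
  rw [card_range]

/-- Many dense sets of integers in an interval share a large difference. -/
lemma exists_common_difference {X : ℕ → Finset ℤ} {r E L lo hi : ℕ}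
    (hX : ∀ i < r, ∀ x ∈ X i, 0 ≤ x ∧ x ≤ hi) (hE : ∀ i < r, E ≤ (X i).card)
    (hr : (hi + 1) * L < r * (E - lo)) :
    ∃ M ∈ Icc lo hi, L ≤ ((range r).filter (fun i => ∃ x ∈ X i, x + (M : ℕ) ∈ X i)).card := by
  by_contra! hcon
  -- Double counting of the pairs (i, M) for which M is a difference of `X i`.
  have h1 := sum_card_bipartiteAbove_eq_sum_card_bipartiteBelow (s := range r) (t := Icc lo hi)
    (fun i M => ∃ x ∈ X i, x + (M : ℕ) ∈ X i)
  have h2 : r * (E - lo) ≤ ∑ i ∈ range r, (bipartiteAbove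
      (fun i M => ∃ x ∈ X i, x + (M : ℕ) ∈ X i) (Icc lo hi) i).card := by
    have := card_nsmul_le_sum (range r) (fun i => (bipartiteAbove
      (fun i M => ∃ x ∈ X i, x + (M : ℕ) ∈ X i) (Icc lo hi) i).card) (E - lo) (by
        intro i hi'
        rw [mem_range] at hi'
        have h3 := card_le_card_large_differences (lo := lo) (hX i hi')
        have h4 := hE i hi'
        simp only [bipartiteAbove]
        omega)
    simpa using this
  have h3 : ∑ M ∈ Icc lo hi, (bipartiteBelow
      (fun i M => ∃ x ∈ X i, x + (M : ℕ) ∈ X i) (range r) M).card ≤ (Icc lo hi).card * L := by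
    rw [← smul_eq_mul]
    exact sum_le_card_nsmul _ _ _ fun M hM => (hcon M hM).le
  have h4 : (Icc lo hi).card ≤ hi + 1 := by simp
  have h5 : (Icc lo hi).card * L ≤ (hi + 1) * L := Nat.mul_le_mul_right _ h4
  omega

/-- A common difference gives an arithmetic progression of sums. -/
lemma exists_progression_of_common_difference {V : ℕ → Finset ℕ} {X : ℕ → Finset ℤ} {h M : ℕ}
    (I : Finset ℕ) (hX : ∀ i ∈ I, IsSubsetSums (V i) h (X i))
    (hd : ∀ i ∈ I, ∀ j ∈ I, i ≠ j → Disjoint (V i) (V j))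
    (hM : ∀ i ∈ I, ∃ x ∈ X i, x + (M : ℤ) ∈ X i) :
    ∃ b : ℕ, ∀ j ≤ I.card, ∃ S ⊆ I.biUnion V, S.card ≤ I.card * h ∧ ∑ x ∈ S, x = b + j * M := by
  induction I using Finset.induction_on with
  | empty => exact ⟨0, fun j hj => ⟨∅, by simp, by simp, by simp at hj; simp [hj]⟩⟩
  | insert i I hi ih =>
    obtain ⟨b, hb⟩ := ih (fun i hi => hX i (mem_insert_of_mem hi))
      (fun i hi j hj => hd i (mem_insert_of_mem hi) j (mem_insert_of_mem hj))
      (fun i hi => hM i (mem_insert_of_mem hi))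
    obtain ⟨x, hx, hxM⟩ := hM i (mem_insert_self _ _)
    obtain ⟨S₀, hS₀, hS₀c, hS₀x⟩ := hX i (mem_insert_self _ _) x hx
    obtain ⟨S₁, hS₁, hS₁c, hS₁x⟩ := hX i (mem_insert_self _ _) _ hxM
    have hdis : Disjoint (V i) (I.biUnion V) := by
      rw [disjoint_biUnion_right]
      intro j hj
      exact hd i (mem_insert_self _ _) j (mem_insert_of_mem hj) fun h => hi (h ▸ hj)
    -- Each block offers a choice between x and x + M, and the multiple j counts the blocks where
    -- the larger sum is taken.
    have key : ∀ T ⊆ V i, T.card ≤ h → ∀ j ≤ I.card, ∃ S ⊆ (insert i I).biUnion V,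
        S.card ≤ (insert i I).card * h ∧ ∑ x ∈ S, x = ∑ x ∈ T, x + (b + j * M) := by
      intro T hT hTc j hj
      obtain ⟨S, hS, hSc, hSx⟩ := hb j hj
      have hTS : Disjoint T S := disjoint_of_subset_left hT (disjoint_of_subset_right hS hdis)
      refine ⟨T ∪ S, ?_, ?_, ?_⟩
      · rw [biUnion_insert]; exact union_subset_union hT hS
      · rw [card_union_of_disjoint hTS, card_insert_of_notMem hi, add_mul]; omega
      · rw [sum_union hTS, hSx]
    refine ⟨∑ x ∈ S₀, x + b, fun j hj => ?_⟩
    rw [card_insert_of_notMem hi] at hj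
    rcases Nat.eq_zero_or_pos j with rfl | hjpos
    · obtain ⟨S, hS, hSc, hSx⟩ := key S₀ hS₀ hS₀c 0 (Nat.zero_le _)
      exact ⟨S, hS, hSc, by rw [hSx]; ring⟩
    · obtain ⟨j, rfl⟩ : ∃ k, j = k + 1 := ⟨j - 1, by omega⟩
      obtain ⟨S, hS, hSc, hSx⟩ := key S₁ hS₁ hS₁c j (by omega)
      refine ⟨S, hS, hSc, ?_⟩
      have h1 : ∑ x ∈ S₁, x = ∑ x ∈ S₀, x + M := by
        rw [← hS₀x] at hS₁x
        exact_mod_cast hS₁x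
      rw [hSx, h1]; ring

/-! ### Intervals of sums in a robust set -/

section Robust

variable {A : Finset ℕ} {n μ w : ℕ}

/-- Pairwise disjoint parts of a robust set, each with many sums. -/
lemma RobustSet.exists_family (hA : RobustSet A n μ w) {v : ℕ} (hv : μ ≤ v * v)
    (hvμ : v ≤ μ) (hμ : 10 ^ 6 ≤ μ) {u : ℕ} (hu : 1 ≤ u) (hun : 2 * (u * μ) ≤ n) (r : ℕ)
    (hw : r * (2 * v + 100 * u) ≤ w) :
    ∃ V : ℕ → Finset ℕ, ∃ X : ℕ → Finset ℤ,
      (∀ i < r, V i ⊆ A ∧ IsSubsetSums (V i) (100 * u + 2) (X i) ∧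
        (V i).card ≤ 2 * v + 100 * u ∧ u * u * μ ≤ (X i).card) ∧
      ∀ i < r, ∀ j < r, i ≠ j → Disjoint (V i) (V j) := by
  induction r with
  | zero => exact ⟨fun _ => ∅, fun _ => ∅, by simp, by simp⟩
  | succ r ih =>
    rw [add_mul, one_mul] at hw
    obtain ⟨V, X, hVX, hd⟩ := ih (by omega)
    have hWc : ((range r).biUnion V).card ≤ r * (2 * v + 100 * u) := by
      have := card_biUnion_le_card_mul (range r) V _ fun i hi => (hVX i (mem_range.1 hi)).2.2.1
      rwa [card_range] at this
    obtain ⟨V', hV', X', hX', hVc, hXc⟩ := hA.exists_many_sums hv hvμ hμ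
      (W := (range r).biUnion V) u hu hun (by omega)
    have hd' : ∀ i < r, Disjoint (V i) V' := by
      intro i hi
      rw [disjoint_right]
      intro x hx hx'
      exact (mem_sdiff.1 (hV' hx)).2 (mem_biUnion.2 ⟨i, mem_range.2 hi, hx'⟩)
    refine ⟨fun i => if i < r then V i else V', fun i => if i < r then X i else X', ?_, ?_⟩
    · intro i hi
      by_cases h : i < r
      · simpa [h] using hVX i h
      · simpa [h] using ⟨fun x hx => (mem_sdiff.1 (hV' hx)).1, hX', hVc, hXc⟩
    · intro i hi j hj hij
      by_cases h : i < r <;> by_cases h' : j < r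
      · simpa [h, h'] using hd i h j h' hij
      · simpa [h, h'] using hd' i h
      · simpa [h, h'] using (hd' j h').symm
      · omega

/-- The iterated signed sumsets of a robust set cover all residues. -/
lemma RobustSet.nsmul_signedSet_zmod (hA : RobustSet A n μ w) {U : ℕ} (hU : 1 ≤ U)
    (hUn : 2 * (U * μ) ≤ n) (hnU : n ≤ 4 * (U * μ)) {M : ℕ} [NeZero M] (hM : M ≤ 102 * (U * n))
    {W : Finset ℕ} (hW : W.card ≤ w) :
    (2724 * U) • signedSet (ZMod M) (A \ W) = univ := by
  obtain ⟨b, hb, hbn⟩ := hA.exists_large W hW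
  obtain ⟨a, ha, hmax⟩ := exists_max_image (A \ W) id ⟨b, hb⟩
  have hba : b ≤ a := hmax b hb
  have hgrow := card_nsmul_signedSet ha
    (fun x hx => ⟨(hA.mem_Icc x (mem_sdiff.1 hx).1).1, hmax x hx⟩)
    (hA.exists_not_dvd W hW) hU (hA.card_le W hW) (by omega)
  have habs := abs_le_of_mem_nsmul_signedSet
    (fun x hx => (hA.mem_Icc x (mem_sdiff.1 hx).1).2) (6 * U) (B := A \ W)
  have hres := mul_card_le_card_image_zmod (M := M) (S := (6 * U) • signedSet ℤ (A \ W))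
    (lo := -(6 * U * n)) (ℓ := 12 * (U * n)) (by
      intro x hx
      have := abs_le.1 (habs x hx)
      push_cast at this ⊢
      constructor <;> linarith)
  rw [image_nsmul_signedSet] at hres
  set R := (6 * U) • signedSet (ZMod M) (A \ W) with hR
  have hn : 1 ≤ n := by
    have := hA.mem_Icc b (mem_sdiff.1 hb).1
    omega
  have hQ : 1 ≤ U * n := Nat.one_le_iff_ne_zero.2 (by positivity)
  -- At least 3U²μ integers lie in [-6Un, 6Un], and M ≤ 102Un, so they occupy a fixed proportion of
  -- the residues. Linear growth with 152 copies of this proportion then covers everything; 2724 =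
  -- 6(3·151 + 1).
  have hcard : M ≤ 152 * R.card := by
    have h1 : M * (3 * (U * n)) ≤ 152 * R.card * (3 * (U * n)) := by
      calc M * (3 * (U * n)) ≤ M * (3 * (U * (4 * (U * μ)))) := by gcongr
        _ = 4 * (M * (3 * U * (U * μ))) := by ring
        _ ≤ 4 * (M * ((6 * U) • signedSet ℤ (A \ W)).card) := by gcongr
        _ ≤ 4 * (R.card * (12 * (U * n) + M)) := by gcongr
        _ ≤ 4 * (R.card * (12 * (U * n) + 102 * (U * n))) := by gcongr
        _ = _ := by ring
    exact Nat.le_of_mul_le_mul_right h1 (by omega)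
  have hlayer := card_nsmul_of_symmetric_generating (R := R)
    (by
      have := nsmul_subset_nsmul_right (zero_mem_signedSet (R := ZMod M) (A \ W))
        (Nat.zero_le (6 * U))
      exact this (by simp))
    (fun x hx => neg_mem_nsmul_signedSet _ hx)
    (fun T hT h => signedSet_generates (hA.exists_not_dvd W hW) (by omega) T hT h) 151
  have huniv : (3 * 151 + 1) • R = univ := by
    rcases hlayer with h | h
    · refine eq_univ_of_card _ (le_antisymm (card_le_univ _) ?_)
      rw [ZMod.card]
      omega
    · exact h
  rw [← huniv, hR, ← mul_nsmul]
  congr 1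
  ring

/-- Sums of few elements of a robust set cover more than half of all residues. -/
lemma RobustSet.exists_many_residues (hA : RobustSet A n μ w) {v : ℕ} (hv : μ ≤ v * v)
    (hvμ : v ≤ μ) (hμ : 10 ^ 6 ≤ μ) {U : ℕ} (hU : 1 ≤ U)
    (hUn : 2 * (U * μ) ≤ n) (hnU : n ≤ 4 * (U * μ)) {M : ℕ} [NeZero M] (hM : M ≤ 102 * (U * n))
    (hMU : 2 ^ 24 * U ≤ M) {W : Finset ℕ}
    (hw : W.card + (2 * v + 100 * U + 2 ^ 24 * U) ≤ w) :
    ∃ V ⊆ A \ W, ∃ Y : Finset (ZMod M), IsSubsetSums V (2 ^ 25 * U) Y ∧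
      V.card ≤ 2 * v + 100 * U + 2 ^ 24 * U ∧ M < 2 * Y.card := by
  obtain ⟨V, hV, X, hX, hVc, hXc⟩ := hA.exists_many_sums hv hvμ hμ (W := W) U hU hUn (by omega)
  have hY := hX.image_intCast M
  set Y := X.image (Int.cast : ℤ → ZMod M)
  have hn : 1 ≤ n := by nlinarith
  have hQ : 1 ≤ U * n := Nat.one_le_iff_ne_zero.2 (by positivity)
  have hYc : M ≤ 816 * Y.card := by
    have hres := mul_card_le_card_image_zmod (M := M) (S := X) (lo := 0) (ℓ := 102 * (U * n)) (by
      intro x hx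
      have h1 := hX.mem_Icc (n := n)
        (fun y hy => (hA.mem_Icc y (mem_sdiff.1 (hV hy)).1).2) x hx
      refine ⟨h1.1, h1.2.trans ?_⟩
      have : (100 * U + 2) * n ≤ 102 * (U * n) := by nlinarith
      push_cast
      rw [zero_add]
      exact_mod_cast this)
    have h1 : M * (U * n) ≤ 816 * Y.card * (U * n) := by
      calc M * (U * n) ≤ M * (U * (4 * (U * μ))) := by gcongr
        _ = 4 * (M * (U * U * μ)) := by ring
        _ ≤ 4 * (M * X.card) := by gcongr
        _ ≤ 4 * (Y.card * (102 * (U * n) + M)) := by gcongr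
        _ ≤ 4 * (Y.card * (102 * (U * n) + 102 * (U * n))) := by gcongr
        _ = _ := by ring
    exact Nat.le_of_mul_le_mul_right h1 (by omega)
  -- A set of at least M/816 and at most M/2 residues gains at least M/(816·2·2724·U) ≥ M/(2²³U)
  -- from a suitable element.
  obtain ⟨V', hV', Y', hY', hVc', hYc', -⟩ := hY.grow (A := A) (W := W) (w := w)
    (lo := Y.card) (hi := M / 2 + 1) (g := M / (2 ^ 23 * U))
    (fun W' hW' Z hlo hhi => by
      obtain ⟨b, hb, -⟩ := hA.exists_large W' hW'
      obtain ⟨a, ha, hag⟩ := exists_large_shiftGain_zmod (by omega) ⟨b, hb⟩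
        (hA.nsmul_signedSet_zmod hU hUn hnU hM hW') (Y := Z) (by omega)
      refine ⟨a, ha, Nat.div_le_of_le_mul ?_⟩
      calc M ≤ 816 * Z.card := by omega
        _ ≤ 816 * (2 * (2724 * U) * shiftGain Z (a : ZMod M)) := by gcongr
        _ = 4445568 * (U * shiftGain Z (a : ZMod M)) := by ring
        _ ≤ 2 ^ 23 * (U * shiftGain Z (a : ZMod M)) := by gcongr; norm_num
        _ = _ := by ring) hV le_rfl (2 ^ 24 * U) (by omega)
  refine ⟨V', hV', Y', hY'.mono subset_rfl (by omega), by omega, ?_⟩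
  have h1 : M < 2 ^ 23 * U * (M / (2 ^ 23 * U) + 1) :=
    Nat.lt_mul_div_succ M (by positivity)
  -- Since M ≥ 2²⁴U, rounding down the gain costs at most a factor of two.
  have h2 : M ≤ 2 ^ 24 * U * (M / (2 ^ 23 * U)) := by nlinarith
  rcases min_le_iff.1 hYc' with h | h <;> omega

/-- A robust set has all integers of a long interval as sums of few of its elements. -/
lemma RobustSet.exists_interval (hA : RobustSet A n μ w) {v : ℕ} (hv : μ ≤ v * v)
    (hvμ : v ≤ μ) (hμ : 2 ^ 30 ≤ μ) {U : ℕ} (hU : 1 ≤ U)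
    (hUn : 2 * (U * μ) ≤ n) (hnU : n ≤ 4 * (U * μ))
    (hw : 2 ^ 42 * (2 * v + 100 * U) ≤ w) :
    ∃ V ⊆ A, V.card ≤ w ∧ ∃ a : ℕ, ∀ z, a ≤ z → z < a + n →
      ∃ S ⊆ V, S.card ≤ 2 ^ 38 * U ∧ ∑ x ∈ S, x = z := by
  have hμ' : 10 ^ 6 ≤ μ := by omega
  have hnbig : 2 ^ 31 ≤ n := by nlinarith
  obtain ⟨V, X, hVX, hd⟩ := hA.exists_family hv hvμ hμ' hU hUn (2 ^ 41) (by omega)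
  set Q := U * n with hQ
  have hUQ : 2 ^ 31 * U ≤ Q := by rw [hQ, mul_comm]; exact Nat.mul_le_mul_left _ hnbig
  have hnQ : n ≤ Q := Nat.le_mul_of_pos_left _ hU
  have hE : Q ≤ 4 * (U * U * μ) := by
    calc Q ≤ U * (4 * (U * μ)) := Nat.mul_le_mul_left _ hnU
      _ = _ := by ring
  -- Each block has at least Q/4 sums in [0, 102Q], hence at least about Q/8 differences that are at
  -- least Q/8. The pigeonhole needs 2⁴¹/8 = 128·2³¹ to exceed about 102·2³¹.
  obtain ⟨M, hM, hL⟩ := exists_common_difference (X := X) (r := 2 ^ 41) (E := U * U * μ)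
    (L := 2 ^ 31) (lo := Q / 8) (hi := 102 * Q)
    (fun i hi x hx => by
      have h1 := (hVX i hi).2.1.mem_Icc (n := n)
        (fun y hy => (hA.mem_Icc y ((hVX i hi).1 hy)).2) x hx
      refine ⟨h1.1, h1.2.trans ?_⟩
      have : (100 * U + 2) * n ≤ 102 * Q := by rw [hQ]; nlinarith
      exact_mod_cast this)
    (fun i hi => (hVX i hi).2.2.2) (by omega)
  rw [Finset.mem_Icc] at hM
  have : NeZero M := ⟨by omega⟩
  obtain ⟨I, hI, hIc⟩ := exists_subset_card_eq hL
  have hI' : ∀ i ∈ I, i < 2 ^ 41 ∧ ∃ x ∈ X i, x + (M : ℤ) ∈ X i := fun i hi => by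
    simpa only [mem_filter, mem_range] using hI hi
  obtain ⟨b, hb⟩ := exists_progression_of_common_difference (V := V) (X := X) (M := M) I
    (fun i hi => (hVX i (hI' i hi).1).2.1)
    (fun i hi j hj => hd i (hI' i hi).1 j (hI' j hj).1) (fun i hi => (hI' i hi).2)
  rw [hIc] at hb
  set W := I.biUnion V with hW
  have hWc : W.card ≤ 2 ^ 31 * (2 * v + 100 * U) := by
    have := card_biUnion_le_card_mul I V _ fun i hi => (hVX i (hI' i hi).1).2.2.1
    rwa [hIc] at this
  have hWA : W ⊆ A := biUnion_subset.2 fun i hi => (hVX i (hI' i hi).1).1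
  obtain ⟨V₁, hV₁, Y₁, hY₁, hV₁c, hY₁c⟩ := hA.exists_many_residues hv hvμ hμ' hU hUn hnU
    (M := M) hM.2 (by omega) (W := W) (by omega)
  have hWV : (W ∪ V₁).card ≤ 2 ^ 31 * (2 * v + 100 * U) + (2 * v + 100 * U + 2 ^ 24 * U) :=
    (card_union_le _ _).trans (by omega)
  obtain ⟨V₂, hV₂, Y₂, hY₂, hV₂c, hY₂c⟩ := hA.exists_many_residues hv hvμ hμ' hU hUn hnU
    (M := M) hM.2 (by omega) (W := W ∪ V₁) (by omega)
  have hV₁A : V₁ ⊆ A := hV₁.trans sdiff_subset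
  have hV₂A : V₂ ⊆ A := hV₂.trans sdiff_subset
  have hd₁₂ : Disjoint V₁ V₂ := by
    rw [disjoint_right]
    exact fun x hx hx' => (mem_sdiff.1 (hV₂ hx)).2 (mem_union_right _ hx')
  have hdW : Disjoint W (V₁ ∪ V₂) := by
    rw [disjoint_union_right, disjoint_right, disjoint_right]
    exact ⟨fun x hx => (mem_sdiff.1 (hV₁ hx)).2,
      fun x hx hx' => (mem_sdiff.1 (hV₂ hx)).2 (mem_union_left _ hx')⟩
  have hY := hY₁.add hY₂ hd₁₂
  -- Two sets each containing more than half of the residues: Y₁ must meet ρ - Y₂.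
  have hYuniv : ∀ ρ : ZMod M, ρ ∈ Y₁ + Y₂ := by
    intro ρ
    have h1 : ¬ Disjoint Y₁ (Y₂.image (fun y => ρ - y)) := by
      intro hdis
      have h2 := card_le_univ (Y₁ ∪ Y₂.image (fun y => ρ - y))
      rw [card_union_of_disjoint hdis, card_image_of_injective _ sub_right_injective,
        ZMod.card] at h2
      omega
    obtain ⟨y, hy, hy'⟩ := not_disjoint_iff.1 h1
    obtain ⟨y', hy'', rfl⟩ := mem_image.1 hy'
    exact mem_add.2 ⟨_, hy, y', hy'', by ring⟩
  refine ⟨W ∪ (V₁ ∪ V₂), union_subset hWA (union_subset hV₁A hV₂A), ?_,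
    b + 2 ^ 26 * Q, fun z hz hz' => ?_⟩
  · have h1 := card_union_le W (V₁ ∪ V₂)
    have h2 := card_union_le V₁ V₂
    omega
  -- First the residue of z - b is matched. The offset 2²⁶Q keeps the remainder nonnegative, and it
  -- is a multiple of M small enough for the progression, whose span is 2³¹M, roughly 2²⁸Q or more.
  · obtain ⟨S, hS, hSc, hSx⟩ := hY _ (hYuniv ((z - b : ℕ) : ZMod M))
    have hSle : ∑ x ∈ S, x ≤ 2 ^ 26 * Q := by
      calc ∑ x ∈ S, x ≤ S.card * n := by
            rw [← smul_eq_mul]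
            refine sum_le_card_nsmul _ _ _ fun i hi => ?_
            exact (hA.mem_Icc i (union_subset hV₁A hV₂A (hS hi))).2
        _ ≤ (2 ^ 25 * U + 2 ^ 25 * U) * n := by gcongr
        _ = 2 ^ 26 * Q := by rw [hQ]; ring
    have hle : ∑ x ∈ S, x ≤ z - b := by omega
    have hdvd : M ∣ (z - b) - ∑ x ∈ S, x :=
      (Nat.modEq_iff_dvd' hle).1 ((ZMod.natCast_eq_natCast_iff _ _ _).1 hSx)
    obtain ⟨j, hj⟩ := hdvd
    have hjL : j ≤ 2 ^ 31 := by
      by_contra! hlt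
      have h1 : M * 2 ^ 31 ≤ M * j := Nat.mul_le_mul_left _ hlt.le
      omega
    obtain ⟨S', hS', hSc', hSx'⟩ := hb j hjL
    have hdS : Disjoint S' S := disjoint_of_subset_left hS' (disjoint_of_subset_right hS hdW)
    refine ⟨S' ∪ S, union_subset_union hS' hS, ?_, ?_⟩
    · rw [card_union_of_disjoint hdS]
      omega
    · rw [sum_union hdS, hSx', mul_comm j M, ← hj]
      omega

end Robust

/-! ### Extracting a robust set -/

lemma mem_divisibleQuotients {d x : ℕ} (hd : 1 ≤ d) {A : Finset ℕ} :
    x ∈ divisibleQuotients d A ↔ d * x ∈ A := by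
  simp only [divisibleQuotients, mem_image, mem_filter]
  constructor
  · rintro ⟨y, ⟨hy, k, rfl⟩, rfl⟩
    rwa [Nat.mul_div_cancel_left _ hd]
  · intro h
    exact ⟨d * x, ⟨h, dvd_mul_right _ _⟩, Nat.mul_div_cancel_left _ hd⟩

lemma card_divisibleQuotients_filter {d : ℕ} (hd : 1 ≤ d) (A : Finset ℕ) (p : ℕ → Prop)
    [DecidablePred p] :
    ((divisibleQuotients d A).filter p).card =
      (A.filter (fun x => d ∣ x ∧ p (x / d))).card := by
  symm
  refine card_bij (fun x _ => x / d) ?_ ?_ ?_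
  · intro x hx
    obtain ⟨hxA, ⟨k, rfl⟩, hp⟩ := mem_filter.1 hx
    rw [Nat.mul_div_cancel_left _ hd] at hp ⊢
    exact mem_filter.2 ⟨(mem_divisibleQuotients hd).2 hxA, hp⟩
  · intro x hx y hy hxy
    exact Nat.div_left_inj (mem_filter.1 hx).2.1 (mem_filter.1 hy).2.1 |>.1 hxy
  · intro x hx
    obtain ⟨hx, hp⟩ := mem_filter.1 hx
    exact ⟨d * x, mem_filter.2 ⟨(mem_divisibleQuotients hd).1 hx, dvd_mul_right _ _,
      by rwa [Nat.mul_div_cancel_left _ hd]⟩, Nat.mul_div_cancel_left _ hd⟩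

lemma card_divisibleQuotients_add {d : ℕ} (hd : 1 ≤ d) (A : Finset ℕ) :
    (divisibleQuotients d A).card + (A.filter (fun x => ¬ d ∣ x)).card = A.card := by
  have := card_divisibleQuotients_filter hd A (fun _ => True)
  simp only [and_true, filter_true] at this
  rw [this, card_filter_add_card_filter_not]

/-- Every set of positive integers has a large robust set among the truncations of its
quotient sets. -/
lemma exists_robustSet {A : Finset ℕ} {n : ℕ} (hA : A ⊆ Icc 1 n) (hne : A.Nonempty) :
    ∃ d t : ℕ, 1 ≤ d ∧
      A.card ≤ 2 * ((divisibleQuotients d A).filter (· ≤ n / 2 ^ t)).card ∧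
      ∀ w, 2 * ((t + 1) * (t + 2)) * w ≤ A.card →
        RobustSet ((divisibleQuotients d A).filter (· ≤ n / 2 ^ t)) (n / 2 ^ t) (A.card / 4) w := by
  classical
  set m := A.card with hm
  have hmpos : 0 < m := hne.card_pos
  let B : ℕ → ℕ → Finset ℕ := fun d t => (divisibleQuotients d A).filter (· ≤ n / 2 ^ t)
  have hBIcc : ∀ d t, 1 ≤ d → ∀ x ∈ B d t, 1 ≤ x ∧ x ≤ n / 2 ^ t := by
    intro d t hd x hx
    obtain ⟨hx, hxn⟩ := mem_filter.1 hx
    have := mem_Icc.1 (hA ((mem_divisibleQuotients hd).1 hx))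
    exact ⟨Nat.pos_of_mul_pos_left this.1, hxn⟩
  -- The threshold (m/2)(1 + 1/(t+1)) falls from m towards m/2. Consecutive thresholds differ by
  -- m/(2(t+1)(t+2)), which is the number of deletions that can be afforded at the last successful
  -- t.
  let P : ℕ → Prop := fun t => ∃ d, 1 ≤ d ∧ m * (t + 2) ≤ 2 * (t + 1) * (B d t).card
  have hhalf : ∀ t d, m * (t + 2) ≤ 2 * (t + 1) * (B d t).card → m ≤ 2 * (B d t).card := by
    intro t d h
    by_contra! hlt
    nlinarith
  have hP0 : P 0 := by
    refine ⟨1, le_rfl, ?_⟩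
    have : A ⊆ B 1 0 := fun x hx => mem_filter.2 ⟨(mem_divisibleQuotients le_rfl).2 (by simpa),
      by simpa using (mem_Icc.1 (hA hx)).2⟩
    have := card_le_card this
    omega
  have hPn : ¬ P n := by
    rintro ⟨d, hd, h⟩
    have h1 := hhalf n d h
    have h2 : B d n = ∅ := by
      refine eq_empty_of_forall_notMem fun x hx => ?_
      have := hBIcc d n hd x hx
      rw [Nat.div_eq_of_lt n.lt_two_pow_self] at this
      omega
    rw [h2, card_empty] at h1
    omega
  obtain ⟨t, ⟨d, hd, hB⟩, hP1⟩ : ∃ t, P t ∧ ¬ P (t + 1) := by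
    by_contra! hcon
    exact hPn (Nat.rec hP0 (fun t ht => hcon t ht) n)
  have hnext : ∀ d', 1 ≤ d' → 2 * (t + 2) * (B d' (t + 1)).card < m * (t + 3) := by
    intro d' hd'
    by_contra! hlt
    exact hP1 ⟨d', hd', hlt⟩
  have hdiv : n / 2 ^ (t + 1) = n / 2 ^ t / 2 := by rw [pow_succ, Nat.div_div_eq_div_mul]
  refine ⟨d, t, hd, hhalf t d hB, fun w hw => ?_⟩
  have hsd : ∀ W : Finset ℕ, W.card ≤ w → m * (t + 3) ≤ 2 * (t + 2) * (B d t \ W).card := by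
    intro W hW
    have h1 : (B d t).card ≤ (B d t \ W).card + w :=
      tsub_le_iff_right.1 ((Nat.sub_le_sub_left hW _).trans (le_card_sdiff _ _))
    have h2 : (t + 1) * (m * (t + 3)) ≤ (t + 1) * (2 * (t + 2) * (B d t \ W).card) := by
      have h3 := Nat.mul_le_mul_left (t + 2) hB
      have h4 := Nat.mul_le_mul_left (2 * ((t + 1) * (t + 2))) h1
      linarith
    exact Nat.le_of_mul_le_mul_left h2 (by omega)
  refine ⟨hBIcc d t hd, fun W hW => ?_, fun W hW => ?_, fun W hW p hp => ?_⟩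
  · have := hsd W hW
    change m / 4 ≤ (B d t \ W).card
    by_contra! hlt
    have h4 : 4 * (B d t \ W).card ≤ m := by omega
    nlinarith
  · by_contra! hcon
    have h1 : B d t \ W ⊆ B d (t + 1) := by
      intro x hx
      have h2 := hcon x hx
      refine mem_filter.2 ⟨(mem_filter.1 (mem_sdiff.1 hx).1).1, ?_⟩
      rw [hdiv]; omega
    have := hsd W hW
    have := hnext d hd
    have := Nat.mul_le_mul_left (2 * (t + 2)) (card_le_card h1)
    omega
  -- If p divided every survivor, division by p ≥ 2 would also halve the range, so d·p would meet
  -- the threshold at t + 1.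
  · by_contra! hcon
    have h1 : (B d t \ W).card ≤ (B (d * p) (t + 1)).card := by
      refine card_le_card_of_injOn (fun x => x / p) ?_ ?_
      · intro x hx
        obtain ⟨k, rfl⟩ := hcon x hx
        obtain ⟨hx1, hx2⟩ := mem_filter.1 (mem_sdiff.1 hx).1
        rw [mem_divisibleQuotients hd, ← mul_assoc] at hx1
        refine mem_coe.2 (mem_filter.2 ⟨?_, ?_⟩)
        · rw [mem_divisibleQuotients (by nlinarith)]
          simpa [Nat.mul_div_cancel_left k (by omega : 0 < p)] using hx1
        · simp only [Nat.mul_div_cancel_left k (by omega : 0 < p)]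
          rw [hdiv, Nat.le_div_iff_mul_le (by omega)]
          nlinarith
      · intro x hx y hy hxy
        exact Nat.div_left_inj (hcon x hx) (hcon y hy) |>.1 hxy
    have := hsd W hW
    have := hnext (d * p) (by nlinarith)
    have := Nat.mul_le_mul_left (2 * (t + 2)) h1
    omega

/-! ### Lengthening the interval and correcting the divisor -/

/-- Adding further elements lengthens an interval of sums. -/
lemma interval_extend {V : Finset ℕ} {h a len : ℕ}
    (hV : ∀ z, a ≤ z → z < a + len → ∃ S ⊆ V, S.card ≤ h ∧ ∑ x ∈ S, x = z)
    (P : Finset ℕ) (hd : Disjoint V P) (hP : ∀ x ∈ P, x ≤ len) :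
    ∀ z, a ≤ z → z < a + (len + ∑ x ∈ P, x) →
      ∃ S ⊆ V ∪ P, S.card ≤ h + P.card ∧ ∑ x ∈ S, x = z := by
  induction P using Finset.induction_on with
  | empty => simpa using hV
  | insert p P hp ih =>
    rw [disjoint_insert_right] at hd
    have ih := ih hd.2 fun x hx => hP x (mem_insert_of_mem hx)
    have hple := hP p (mem_insert_self _ _)
    intro z hz hz'
    rw [sum_insert hp] at hz'
    rw [card_insert_of_notMem hp, union_insert]
    -- As p is at most the length of the interval, the interval and its translate by p leave no gap.
    rcases lt_or_ge z (a + (len + ∑ x ∈ P, x)) with h | h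
    · obtain ⟨S, hS, hSc, hSx⟩ := ih z hz h
      exact ⟨S, hS.trans (subset_insert _ _), by omega, hSx⟩
    · obtain ⟨S, hS, hSc, hSx⟩ := ih (z - p) (by omega) (by omega)
      have hpS : p ∉ S := fun hpS => by
        rcases mem_union.1 (hS hpS) with h | h
        · exact hd.1 h
        · exact hp h
      refine ⟨insert p S, insert_subset_insert _ hS, ?_, ?_⟩
      · rw [card_insert_of_notMem hpS]; omega
      · rw [sum_insert hpS, hSx]; omega

/-- If no nontrivial divisor of `q` divides all but `q` elements of `A`, then the subset sums of at
most `q` elements of `A` cover all residues modulo `q`. -/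
lemma exists_subset_sums_cover_zmod {A : Finset ℕ} {q : ℕ} [NeZero q]
    (hA : ∀ e, 2 ≤ e → e ∣ q → q < (A.filter (fun x => ¬ e ∣ x)).card) :
    ∃ S ⊆ A, (∀ x ∈ S, ¬ q ∣ x) ∧ S.card ≤ q ∧ IsSubsetSums S q (univ : Finset (ZMod q)) := by
  have key : ∀ k ≤ q, ∃ S ⊆ A, (∀ x ∈ S, ¬ q ∣ x) ∧ S.card ≤ k ∧ ∃ Y : Finset (ZMod q),
      IsSubsetSums S k Y ∧ Y.Nonempty ∧ (k + 1 ≤ Y.card ∨ Y = univ) := by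
    intro k hk
    induction k with
    | zero =>
      refine ⟨∅, by simp, by simp, by simp, {0}, ?_, by simp, by simp⟩
      intro x hx
      exact ⟨∅, by simp, by simp, by simpa using (mem_singleton.1 hx).symm⟩
    | succ k ih =>
      obtain ⟨S, hS, hSq, hSc, Y, hY, hYne, hYc⟩ := ih (by omega)
      by_cases huniv : Y = univ
      · exact ⟨S, hS, hSq, by omega, Y, hY.mono subset_rfl (by omega), hYne, Or.inr huniv⟩
      have hYc : k + 1 ≤ Y.card := hYc.resolve_right huniv
      -- Otherwise Y is stable under A \ S. No divisor p ≥ 2 of q divides all of A \ S, since more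
      -- than q elements of A are not multiples of p and S has at most q elements; so Y would be
      -- everything. An x that moves Y is not a multiple of q.
      obtain ⟨x, hx, y, hy, hyx⟩ : ∃ x ∈ A \ S, ∃ y ∈ Y, y + (x : ZMod q) ∉ Y := by
        by_contra! hcon
        refine huniv (zmod_eq_univ_of_stable hYne (B := A \ S) (fun p hp hpq => ?_)
          fun y hy x hx => hcon x hx y hy)
        by_contra! hall
        have h1 : A.filter (fun x => ¬ p ∣ x) ⊆ S := by
          intro x hx
          by_contra hxS
          exact (mem_filter.1 hx).2 (hall x (mem_sdiff.2 ⟨(mem_filter.1 hx).1, hxS⟩))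
        have := card_le_card h1
        have := hA p hp hpq
        omega
      rw [mem_sdiff] at hx
      refine ⟨insert x S, insert_subset hx.1 hS, ?_, ?_, Y ∪ Y.image (· + (x : ZMod q)),
        hY.union_translate hx.2, hYne.mono subset_union_left, Or.inl ?_⟩
      · intro z hz
        rcases mem_insert.1 hz with rfl | hz
        · intro hq
          rw [(ZMod.natCast_eq_zero_iff _ _).2 hq, add_zero] at hyx
          exact hyx hy
        · exact hSq z hz
      · rw [card_insert_of_notMem hx.2]; omega
      · rw [card_union_image_add]
        have : 0 < shiftGain Y (x : ZMod q) :=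
          card_pos.2 ⟨_, mem_sdiff.2 ⟨mem_image_of_mem _ hy, hyx⟩⟩
        omega
  obtain ⟨S, hS, hSq, hSc, Y, hY, -, hYc⟩ := key q le_rfl
  have huniv : Y = univ := hYc.resolve_left fun h => by
    have := card_le_univ Y
    rw [ZMod.card] at this
    omega
  exact ⟨S, hS, hSq, hSc, huniv ▸ hY⟩

/-- Every `d` has a divisor `d'` that divides almost all elements of `A`, and whose multiples in `A`
have sums in all the multiples of `d'` modulo `d`. -/
lemma exists_divisor_cover (A : Finset ℕ) {d : ℕ} (hd : 1 ≤ d) :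
    ∃ d' q : ℕ, d = d' * q ∧ (A.filter (fun x => ¬ d' ∣ x)).card ≤ 2 * d ∧
      ∃ S ⊆ divisibleQuotients d' A, (∀ x ∈ S, ¬ q ∣ x) ∧
        ∀ z : ℕ, ∃ T ⊆ S, T.card ≤ q ∧ ∑ x ∈ T, x ≡ z [MOD q] := by
  -- The term 2(d/e) is a budget for further losses. If at most q elements of A/d' were not
  -- multiples of some e ≥ 2 dividing q = d/d', passing to d'e would lose at most q more elements
  -- and release 2q - 2q/e ≥ q of the budget, against the maximality of d'.
  let D := d.divisors.filter
    (fun e => (A.filter (fun x => ¬ e ∣ x)).card + 2 * (d / e) ≤ 2 * d)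
  have hD : D.Nonempty := ⟨1, mem_filter.2 ⟨Nat.one_mem_divisors.2 (by omega), by simp⟩⟩
  obtain ⟨d', hd', hmax⟩ := exists_max_image D id hD
  obtain ⟨h1, hloss⟩ := mem_filter.1 hd'
  obtain ⟨q, hq⟩ := (Nat.mem_divisors.1 h1).1
  have hd'pos : 1 ≤ d' := Nat.pos_of_mem_divisors h1
  have hqpos : 1 ≤ q := Nat.pos_of_ne_zero fun h => by simp [h] at hq; omega
  have hdq : d / d' = q := by rw [hq, Nat.mul_div_cancel_left _ hd'pos]
  rw [hdq] at hloss
  have : NeZero q := ⟨by omega⟩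
  obtain ⟨S, hS, hSq, -, hcover⟩ := exists_subset_sums_cover_zmod (A := divisibleQuotients d' A)
    (q := q) (by
      intro e he heq
      obtain ⟨k, rfl⟩ := heq
      have hlt : d' < d' * e := by nlinarith
      have hnot : d' * e ∉ D := fun h => by
        have : d' * e ≤ d' := hmax _ h
        omega
      have hdvd : d = d' * e * k := by rw [hq, mul_assoc]
      have hmem : d' * e ∈ d.divisors := Nat.mem_divisors.2 ⟨⟨k, hdvd⟩, by omega⟩
      have hgt : 2 * d < (A.filter (fun x => ¬ d' * e ∣ x)).card + 2 * (d / (d' * e)) := by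
        by_contra! h
        exact hnot (mem_filter.2 ⟨hmem, h⟩)
      have hk : d / (d' * e) = k := by
        conv_lhs => rw [hdvd]
        exact Nat.mul_div_cancel_left _ (by omega)
      rw [hk] at hgt
      rw [card_divisibleQuotients_filter hd'pos]
      have hsub : A.filter (fun x => ¬ d' * e ∣ x) ⊆ A.filter (fun x => ¬ d' ∣ x) ∪
          A.filter (fun x => d' ∣ x ∧ ¬ e ∣ x / d') := by
        intro x hx
        obtain ⟨hxA, hxe⟩ := mem_filter.1 hx
        by_cases hdx : d' ∣ x
        · refine mem_union_right _ (mem_filter.2 ⟨hxA, hdx, fun h => hxe ?_⟩)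
          exact (Nat.dvd_div_iff_mul_dvd hdx).1 h
        · exact mem_union_left _ (mem_filter.2 ⟨hxA, hdx⟩)
      have h2 := (card_le_card hsub).trans (card_union_le _ _)
      have h3 : 2 * k ≤ e * k := Nat.mul_le_mul_right _ he
      omega)
  refine ⟨d', q, hq, by omega, S, hS, hSq, fun z => ?_⟩
  obtain ⟨T, hT, hTc, hTz⟩ := hcover (z : ZMod q) (mem_univ _)
  exact ⟨T, hT, hTc, (ZMod.natCast_eq_natCast_iff _ _ _).1 hTz⟩

/-- Sums of multiples of `q` and a set of sums covering the residues modulo `q` fill an interval. -/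
lemma interval_of_cover {A V S : Finset ℕ} {d' q n a h : ℕ} (hd' : 1 ≤ d') (hq : 1 ≤ q)
    (hA : A ⊆ Icc 1 n) (hVA : V ⊆ divisibleQuotients (d' * q) A)
    (hSA : S ⊆ divisibleQuotients d' A) (hSq : ∀ x ∈ S, ¬ q ∣ x)
    (hV : ∀ z, a ≤ z → z < a + 2 * n → ∃ T ⊆ V, T.card ≤ h ∧ ∑ x ∈ T, x = z)
    (hS : ∀ z : ℕ, ∃ T ⊆ S, T.card ≤ q ∧ ∑ x ∈ T, x ≡ z [MOD q]) :
    ∀ z, q * a + q * n ≤ z → z < q * a + q * n + n →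
      ∃ T ⊆ divisibleQuotients d' A, T.card ≤ h + q ∧ ∑ x ∈ T, x = z := by
  intro z hz hz'
  -- T fixes the residue modulo q, and q times a sum from V supplies the rest. Elements of S are not
  -- multiples of q, so the two sets of summands are disjoint.
  obtain ⟨T, hT, hTc, hTz⟩ := hS z
  have hTle : ∑ x ∈ T, x ≤ q * n := by
    calc ∑ x ∈ T, x ≤ T.card * n := by
          rw [← smul_eq_mul]
          refine sum_le_card_nsmul _ _ _ fun i hi => ?_
          have h1 := (mem_Icc.1 (hA ((mem_divisibleQuotients hd').1 (hSA (hT hi))))).2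
          exact (Nat.le_mul_of_pos_left i hd').trans h1
      _ ≤ q * n := Nat.mul_le_mul_right _ hTc
  obtain ⟨j, hj⟩ := (Nat.modEq_iff_dvd' (by omega : ∑ x ∈ T, x ≤ z)).1 hTz
  have hja : a ≤ j := by
    have : q * a ≤ q * j := by omega
    exact Nat.le_of_mul_le_mul_left this hq
  have hnq : n ≤ q * n := Nat.le_mul_of_pos_left _ hq
  have hjb : j < a + 2 * n := by
    refine Nat.lt_of_mul_lt_mul_left (a := q) ?_
    rw [mul_add, ← hj]
    have : q * (2 * n) = q * n + q * n := by ring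
    omega
  obtain ⟨U, hU, hUc, hUj⟩ := hV j hja hjb
  have hinj : Function.Injective (q * ·) := mul_right_injective₀ (by omega : q ≠ 0)
  have hdis : Disjoint (U.image (q * ·)) T := by
    rw [disjoint_right]
    intro x hx hx'
    obtain ⟨y, -, rfl⟩ := mem_image.1 hx'
    exact hSq _ (hT hx) (dvd_mul_right _ _)
  refine ⟨U.image (q * ·) ∪ T, union_subset ?_ (hT.trans hSA), ?_, ?_⟩
  · intro x hx
    obtain ⟨y, hy, rfl⟩ := mem_image.1 hx
    have := (mem_divisibleQuotients (Nat.mul_pos hd' hq)).1 (hVA (hU hy))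
    rw [mem_divisibleQuotients hd']
    rwa [mul_assoc] at this
  · rw [card_union_of_disjoint hdis, card_image_of_injective _ hinj]
    omega
  · rw [sum_union hdis, sum_image hinj.injOn, ← mul_sum, hUj, ← hj]
    omega

/-! ### Choice of parameters and conclusion -/

lemma mul_succ_le_two_pow (t : ℕ) : (t + 1) * (t + 2) ≤ 3 * 2 ^ t := by
  induction t with
  | zero => norm_num
  | succ t ih =>
    rcases lt_or_ge t 2 with h | h
    · interval_cases t <;> norm_num
    · rw [pow_succ]
      nlinarith

/-- Robustness costs a factor (t+1)(t+2), while truncation shrinks the range by 2^t, so no logarithm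
of n is lost. The square is needed for the term v, of order √m. -/
lemma sq_mul_succ_le_two_pow (t : ℕ) : ((t + 1) * (t + 2)) ^ 2 ≤ 2 ^ 6 * 2 ^ t := by
  induction t with
  | zero => norm_num
  | succ t ih =>
    rcases lt_or_ge t 5 with h | h
    · interval_cases t <;> norm_num
    · have h1 : ((t + 1 + 1) * (t + 1 + 2)) ^ 2 ≤ 2 * ((t + 1) * (t + 2)) ^ 2 := by
        obtain ⟨k, rfl⟩ := Nat.exists_eq_add_of_le h
        have : (5 + k + 1 + 2) ^ 2 ≤ 2 * (5 + k + 1) ^ 2 := by nlinarith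
        calc ((5 + k + 1 + 1) * (5 + k + 1 + 2)) ^ 2
            = (5 + k + 2) ^ 2 * (5 + k + 1 + 2) ^ 2 := by ring
          _ ≤ (5 + k + 2) ^ 2 * (2 * (5 + k + 1) ^ 2) := Nat.mul_le_mul_left _ this
          _ = _ := by ring
      rw [pow_succ 2 t]
      omega

/-- The size conditions needed to find an interval of sums in a robust set. -/
lemma robust_parameters {n m t N U μ v : ℕ} (hm : 2 ^ 120 * n ≤ m * m) (hN : 2 ^ t * N ≤ n)
    (hmN : m ≤ 2 * N) (hmpos : 1 ≤ m) (hμ : m ≤ 5 * μ) (hμm : 4 * μ ≤ m)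
    (hU : U * (2 * μ) ≤ N) (hv : v * v ≤ 4 * μ) :
    2 * ((t + 1) * (t + 2)) * (2 ^ 42 * (2 * v + 100 * U)) ≤ m := by
  set s := (t + 1) * (t + 2) with hs
  have h1 : s ≤ 3 * 2 ^ t := mul_succ_le_two_pow t
  have h2 : s ^ 2 ≤ 2 ^ 6 * 2 ^ t := sq_mul_succ_le_two_pow t
  have hsU : 2 ^ 110 * (s * U) ≤ m := by
    have h3 : s * U * m ≤ 8 * n := by
      calc s * U * m ≤ 3 * 2 ^ t * U * (5 * μ) := by gcongr
        _ ≤ 8 * (2 ^ t * (U * (2 * μ))) := by nlinarith [Nat.zero_le (2 ^ t * U * μ)]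
        _ ≤ 8 * (2 ^ t * N) := by gcongr
        _ ≤ 8 * n := by gcongr
    have h4 : 2 ^ 110 * (s * U) * m ≤ m * m := by nlinarith
    exact Nat.le_of_mul_le_mul_right h4 hmpos
  have hsv : 2 ^ 50 * (s * v) ≤ m := by
    have h3 : 2 ^ t * m ≤ 2 * n := by nlinarith [Nat.zero_le (2 ^ t)]
    have h4 : (2 ^ 50 * (s * v)) ^ 2 ≤ m ^ 2 := by
      calc (2 ^ 50 * (s * v)) ^ 2 = 2 ^ 100 * s ^ 2 * (v * v) := by ring
        _ ≤ 2 ^ 100 * (2 ^ 6 * 2 ^ t) * m := by gcongr; omega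
        _ = 2 ^ 106 * (2 ^ t * m) := by ring
        _ ≤ 2 ^ 106 * (2 * n) := by gcongr
        _ ≤ m ^ 2 := by nlinarith
    exact (Nat.pow_le_pow_iff_left (by norm_num)).1 h4
  have h5 : 2 * s * (2 ^ 42 * (2 * v + 100 * U)) =
      2 ^ 44 * (s * v) + 100 * 2 ^ 43 * (s * U) := by ring
  rw [h5]
  omega

/-- The theorem in terms of natural numbers, with a stronger bound for the exceptional set. -/
lemma exists_interval_of_large {A : Finset ℕ} {n : ℕ} (hn : 0 < n) (hA : A ⊆ Icc 1 n)
    (hm : 2 ^ 120 * n ≤ A.card * A.card) :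
    ∃ d : ℕ, 1 ≤ d ∧
      (∃ a : ℕ, ∀ z, a ≤ z → z < a + n → ∃ T ⊆ divisibleQuotients d A,
        T.card * A.card ≤ 2 ^ 50 * n ∧ ∑ x ∈ T, x = z) ∧
      (A.filter (fun x => ¬ d ∣ x)).card * A.card ≤ 4 * n := by
  set m := A.card with hmdef
  have hmn : m ≤ n := by
    have := card_le_card hA
    simpa using this
  have hmpos : 0 < m := by
    by_contra! h
    have : m = 0 := by omega
    rw [this] at hm
    omega
  have hmbig : 2 ^ 120 ≤ m := by
    refine Nat.le_of_mul_le_mul_right ?_ hmpos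
    exact (Nat.mul_le_mul_left _ hmn).trans hm
  obtain ⟨d, t, hd, hBm, hrob⟩ := exists_robustSet hA (card_pos.1 hmpos)
  rw [← hmdef] at hBm hrob
  set N := n / 2 ^ t with hN
  set B := (divisibleQuotients d A).filter (· ≤ N) with hB
  have hBA : B ⊆ divisibleQuotients d A := filter_subset _ _
  have hdB : ∀ x ∈ B, 1 ≤ x ∧ d * x ≤ n := by
    intro x hx
    have := mem_Icc.1 (hA ((mem_divisibleQuotients hd).1 (hBA hx)))
    exact ⟨Nat.pos_of_mul_pos_left this.1, this.2⟩
  have hBN : B.card ≤ N := by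
    have : B ⊆ Icc 1 N := fun x hx => mem_Icc.2 ⟨(hdB x hx).1, (mem_filter.1 hx).2⟩
    simpa using card_le_card this
  -- At least m/2 distinct multiples of d lie in [1, n]; this bounds both q and the number of
  -- discarded elements.
  have hdm : m * d ≤ 2 * n := by
    have h1 : B ⊆ Icc 1 (n / d) := fun x hx => mem_Icc.2
      ⟨(hdB x hx).1, (Nat.le_div_iff_mul_le hd).2 (by rw [mul_comm]; exact (hdB x hx).2)⟩
    have h2 : B.card ≤ n / d := by simpa using card_le_card h1
    have h3 : B.card * d ≤ n := (Nat.le_div_iff_mul_le hd).1 h2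
    calc m * d ≤ 2 * B.card * d := Nat.mul_le_mul_right _ hBm
      _ = 2 * (B.card * d) := mul_assoc _ _ _
      _ ≤ 2 * n := Nat.mul_le_mul_left _ h3
  have htN : 2 ^ t * N ≤ n := Nat.mul_div_le _ _
  have hNn : N ≤ n := Nat.div_le_self _ _
  set μ := m / 4 with hμ
  set U := N / (2 * μ) with hU
  set v := Nat.sqrt μ + 1 with hv
  have hUN : U * (2 * μ) ≤ N := Nat.div_mul_le_self _ _
  have hU1 : 1 ≤ U := (Nat.le_div_iff_mul_le (by omega)).2 (by omega)
  have hNU : N ≤ 4 * (U * μ) := by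
    have h1 : N < 2 * μ * (U + 1) := Nat.lt_mul_div_succ N (by omega)
    have h2 : μ ≤ U * μ := Nat.le_mul_of_pos_left _ hU1
    have h3 : 2 * μ * (U + 1) = 2 * (U * μ) + 2 * μ := by ring
    omega
  have hμv : μ ≤ v * v := (Nat.lt_succ_sqrt μ).le
  have hvμ4 : v * v ≤ 4 * μ := by
    have h1 : 1 ≤ Nat.sqrt μ := Nat.le_sqrt.2 (by omega)
    have h2 := Nat.sqrt_le μ
    nlinarith
  have hvμ : v ≤ μ := by
    by_contra! h
    have : 4 ≤ μ := by omega
    nlinarith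
  have hR := hrob (2 ^ 42 * (2 * v + 100 * U))
    (robust_parameters hm htN (by omega) hmpos (by omega) (by omega) hUN hvμ4)
  obtain ⟨V, hVB, hVc, a, hVa⟩ := hR.exists_interval hμv hvμ (by omega) hU1
    (by rw [show 2 * (U * μ) = U * (2 * μ) by ring]; exact hUN) hNU le_rfl
  -- The interval from the robust set has length only N. Adjoining p unused elements larger than
  -- m/16 adds more than 2n to its length.
  set p := 32 * n / m + 1 with hp
  have hpm : p * m ≤ 33 * n := by
    have := Nat.div_mul_le_self (32 * n) m
    rw [hp, add_mul]; omega
  have hpm' : 32 * n < p * m := by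
    rw [mul_comm p m]
    exact Nat.lt_mul_div_succ _ hmpos
  have hpc : p ≤ ((B \ V).filter (fun x => ¬ x ≤ m / 16)).card := by
    have h1 := hR.card_le V hVc
    have h2 := card_filter_add_card_filter_not (s := B \ V) (fun x => x ≤ m / 16)
    have h3 : ((B \ V).filter (fun x => x ≤ m / 16)).card ≤ m / 16 := by
      have : (B \ V).filter (fun x => x ≤ m / 16) ⊆ Icc 1 (m / 16) := fun x hx =>
        mem_Icc.2 ⟨(hdB x (mem_sdiff.1 (mem_filter.1 hx).1).1).1, (mem_filter.1 hx).2⟩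
      simpa using card_le_card this
    have h4 : 2 ^ 100 * p ≤ m := by
      have : 2 ^ 100 * p * m ≤ m * m := by rw [mul_assoc]; omega
      exact Nat.le_of_mul_le_mul_right this hmpos
    omega
  obtain ⟨P, hP, hPc⟩ := exists_subset_card_eq hpc
  have hPB : ∀ x ∈ P, x ∈ B ∧ x ∉ V ∧ m / 16 < x := fun x hx => by
    have := mem_filter.1 (hP hx)
    rw [mem_sdiff] at this
    exact ⟨this.1.1, this.1.2, by omega⟩
  have hPsum : 2 * n ≤ ∑ x ∈ P, x := by
    have h1 : p * (m / 16 + 1) ≤ ∑ x ∈ P, x := by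
      rw [← hPc, ← smul_eq_mul]
      exact card_nsmul_le_sum _ _ _ fun x hx => (hPB x hx).2.2
    have h2 : p * m ≤ p * (16 * (m / 16 + 1)) := Nat.mul_le_mul_left _ (by omega)
    have h3 : p * (16 * (m / 16 + 1)) = 16 * (p * (m / 16 + 1)) := by ring
    omega
  have hVP := interval_extend hVa P (disjoint_right.2 fun x hx => (hPB x hx).2.1)
    (fun x hx => (mem_filter.1 (hPB x hx).1).2)
  obtain ⟨d', q, rfl, hloss, S, hS, hSq, hScover⟩ := exists_divisor_cover A hd
  have hd' : 1 ≤ d' := Nat.pos_of_mul_pos_right hd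
  have hq : 1 ≤ q := Nat.pos_of_mul_pos_left hd
  have hint := interval_of_cover (V := V ∪ P) hd' hq hA
    (union_subset (hVB.trans hBA) fun x hx => hBA (hPB x hx).1) hS hSq
    (fun z hz hz' => hVP z hz (by omega)) hScover
  refine ⟨d', hd', ⟨q * a + q * n, fun z hz hz' => ?_⟩, ?_⟩
  · obtain ⟨T, hT, hTc, hTz⟩ := hint z hz hz'
    refine ⟨T, hT, ?_, hTz⟩
    have hUm : U * m ≤ 3 * n := by
      have h1 : U * m ≤ U * (5 * μ) := Nat.mul_le_mul_left _ (by omega)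
      have h2 : 2 * (U * (5 * μ)) = 5 * (U * (2 * μ)) := by ring
      omega
    have hqm : q * m ≤ 2 * n := by
      calc q * m ≤ d' * q * m := Nat.mul_le_mul_right _ (Nat.le_mul_of_pos_left _ hd')
        _ = m * (d' * q) := mul_comm _ _
        _ ≤ 2 * n := hdm
    rw [hPc] at hTc
    calc T.card * m ≤ (2 ^ 38 * U + p + q) * m := Nat.mul_le_mul_right _ hTc
      _ = 2 ^ 38 * (U * m) + p * m + q * m := by ring
      _ ≤ 2 ^ 50 * n := by omega
  · calc (A.filter (fun x => ¬ d' ∣ x)).card * m ≤ 2 * (d' * q) * m :=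
          Nat.mul_le_mul_right m hloss
      _ = 2 * (m * (d' * q)) := by ring
      _ ≤ 2 * (2 * n) := Nat.mul_le_mul_left _ hdm
      _ = 4 * n := by ring

theorem mainTheorem8 :
    ∃ C : ℝ, 0 < C ∧
      ∀ n : ℕ, 0 < n → ∀ A : Finset ℕ, A ⊆ Finset.Icc 1 n →
        C * Real.sqrt (n : ℝ) ≤ (A.card : ℝ) →
        ∃ d : ℕ, 1 ≤ d ∧
          (∃ a L : ℕ, n ≤ L ∧
            Set.Ico a (a + L) ⊆
              shortSubsetSums ((2 : ℝ) ^ 50 * (n : ℝ) / (A.card : ℝ)) (divisibleQuotients d A)) ∧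
          (A.card : ℝ) - ((divisibleQuotients d A).card : ℝ) ≤
            (2 : ℝ) ^ 30 * (Real.log (n : ℝ)) ^ 3 + (2 : ℝ) ^ 30 * (n : ℝ) / (A.card : ℝ) := by
  refine ⟨2 ^ 60, by positivity, fun n hn A hA hC => ?_⟩
  have hn' : (0 : ℝ) < n := by exact_mod_cast hn
  have hmpos : (0 : ℝ) < A.card := lt_of_lt_of_le (by positivity) hC
  have hm : 2 ^ 120 * n ≤ A.card * A.card := by
    have h1 := mul_self_le_mul_self (by positivity) hC
    have h2 : (2 : ℝ) ^ 60 * √n * (2 ^ 60 * √n) = 2 ^ 120 * n := by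
      rw [mul_mul_mul_comm, Real.mul_self_sqrt hn'.le]; ring
    rw [h2] at h1
    exact_mod_cast h1
  obtain ⟨d, hd, ⟨a, ha⟩, hloss⟩ := exists_interval_of_large hn hA hm
  refine ⟨d, hd, ⟨a, n, le_rfl, fun z hz => ?_⟩, ?_⟩
  · obtain ⟨T, hT, hTc, hTz⟩ := ha z hz.1 hz.2
    refine ⟨T, hT, ?_, hTz⟩
    rw [le_div_iff₀ hmpos]
    exact_mod_cast hTc
  · have h1 : (A.card : ℝ) - (divisibleQuotients d A).card =
        (A.filter (fun x => ¬ d ∣ x)).card := by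
      rw [← card_divisibleQuotients_add hd A]; push_cast; ring
    have h2 : ((A.filter (fun x => ¬ d ∣ x)).card : ℝ) ≤ 2 ^ 30 * n / A.card := by
      rw [le_div_iff₀ hmpos]
      have : ((A.filter (fun x => ¬ d ∣ x)).card : ℝ) * A.card ≤ 4 * n := by
        exact_mod_cast hloss
      refine this.trans ?_
      gcongr
      norm_num
    have h3 : 0 ≤ Real.log n := Real.log_natCast_nonneg n
    -- The loss is already at most 4n/m, so the logarithmic term only has to be nonnegative.
    have h4 : 0 ≤ (2 : ℝ) ^ 30 * Real.log n ^ 3 := by positivity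
    rw [h1]
    linarith
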